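/- Let $\mathring T,\mathring R,\beta>0$. For $\alpha\in\mathbb R$ consider the positive $C^2$ functions $\phi$ on $S^1=\mathbb R/2\pi\mathbb Z$ that solve $$\frac{(2\pi)^2}{\mathring T^2}\,\frac{d^2\phi}{d\psi^2}=-\frac18\left(\beta^2\phi^5+\alpha^2\phi^{-7}-\mathring R\,\phi\right),\qquad(\ast)$$ where two solutions that differ by a translation $\psi\mapsto\psi+s$ of $S^1$ are identified. Let $\alpha_{\max}=\frac{2}{3\sqrt3\,\beta^2}\mathring R^{3/2}$, let $k_{\max}$ be the largest integer $k$ with $2\left(\frac{2\pi}{\mathring T}\right)^2k^2<\mathring R$, and for $0\le k\le k_{\max}$ let $$\alpha_{k,\pm}=\pm\frac{2}{3\sqrt3\,\beta^2}\left(\mathring R+\left(\tfrac{2\pi}{\mathring T}\right)^2k^2\right)\sqrt{\mathring R-2\left(\tfrac{2\pi}{\mathring T}\right)^2k^2}.$$ Then: 1. If $|\alpha|>\alpha_{\max}$, then $(\ast)$ has no solution. 2. If $|\alpha|=\alpha_{\max}$, then $(\ast)$ has exactly one solution. 3. Let $0\le k\le k_{\max}$ and $\alpha\ne0$, with $\alpha\in(\alpha_{k,-},\alpha_{k+1,-}]\cup[\alpha_{k+1,+},\alpha_{k,+})$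 if $k<k_{\max}$, and $\alpha\in(\alpha_{k,-},\alpha_{k,+})$ if $k=k_{\max}$. Then $(\ast)$ has exactly two constant solutions and exactly $k$ non-constant solutions, and for each $n\in\{1,\dots,k\}$ exactly one of the latter has index $n$. Here the index of a non-constant solution $\phi$ is the class of the closed curve $\psi\mapsto(\phi,\dot\phi)$, with $\dot\phi=\frac{2\pi}{\mathring T}\frac{d\phi}{d\psi}$, in $\pi_1\big(\mathbb R^2\setminus\{(\phi_+(\alpha),0)\}\big)\simeq\mathbb Z$, that is, its number of clockwise turns around $(\phi_+(\alpha),0)$, where $\phi_+(\alpha)$ is the larger of the two constant solutions. -/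

import Mathlib

open Real

/-- Positive `C²` solutions `φ` on the circle (that is, `2π`-periodic functions of `ψ ∈ ℝ`) of
`((2π)² / T²) φ'' = -(1/8) (β² φ⁵ + α² φ⁻⁷ - R φ)`. -/
structure IsLichSolution (T R β α : ℝ) (φ : ℝ → ℝ) : Prop where
  contDiff : ContDiff ℝ 2 φ
  periodic : Function.Periodic φ (2 * π)
  pos : ∀ ψ, 0 < φ ψ
  ode : ∀ ψ, (2 * π) ^ 2 / T ^ 2 * deriv (deriv φ) ψ =
    -(1 / 8) * (β ^ 2 * φ ψ ^ 5 + α ^ 2 * φ ψ ^ (-7 : ℤ) - R * φ ψ)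

/-- The type of solutions. -/
def LichSolution (T R β α : ℝ) : Type := {φ : ℝ → ℝ // IsLichSolution T R β α φ}

/-- Two solutions are equivalent when they differ by a translation of the circle. -/
def translationSetoid (T R β α : ℝ) : Setoid (LichSolution T R β α) where
  r φ χ := ∃ s : ℝ, ∀ ψ, χ.1 ψ = φ.1 (ψ + s)
  iseqv :=
    { refl := fun _ => ⟨0, fun ψ => by rw [add_zero]⟩
      symm := fun {φ χ} ⟨s, h⟩ => ⟨-s, fun ψ => by rw [h (ψ + -s), neg_add_cancel_right]⟩
      trans := fun {φ χ ω} ⟨s, h⟩ ⟨t, h'⟩ => ⟨t + s, fun ψ => by rw [h' ψ, h (ψ + t), add_assoc]⟩ }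

/-- Solutions up to translation. -/
def LichClass (T R β α : ℝ) : Type := Quotient (translationSetoid T R β α)

/-- The class of a solution up to translation. -/
def LichSolution.toClass {T R β α : ℝ} (φ : LichSolution T R β α) : LichClass T R β α :=
  Quotient.mk (translationSetoid T R β α) φ

/-- The solution is a constant function. -/
def LichSolution.IsConst {T R β α : ℝ} (φ : LichSolution T R β α) : Prop :=
  ∃ c : ℝ, ∀ ψ, φ.1 ψ = c

/-- The classes of constant solutions. -/
def constClasses (T R β α : ℝ) : Set (LichClass T R β α) :=
  {q | ∃ φ : LichSolution T R β α, φ.toClass = q ∧ φ.IsConst}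

/-- The classes of non-constant solutions. -/
def nonconstClasses (T R β α : ℝ) : Set (LichClass T R β α) :=
  {q | ∃ φ : LichSolution T R β α, φ.toClass = q ∧ ¬ φ.IsConst}

/-- The larger constant solution `φ₊(α)`. -/
noncomputable def phiPlus (T R β α : ℝ) : ℝ :=
  sSup {c : ℝ | IsLichSolution T R β α (fun _ => c)}

/-- The class of the `2π`-periodic plane curve `ψ ↦ (x ψ, y ψ)` in
`π₁(ℝ² ∖ {(a, b)}) ≃ ℤ` is `n`, the generator being a circle run through once clockwise: the curve
avoids `(a, b)`, and its continuous clockwise polar angle `θ` about `(a, b)` increases by `2πn`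
along one period. -/
def WindsClockwise (x y : ℝ → ℝ) (a b : ℝ) (n : ℤ) : Prop :=
  ∃ r θ : ℝ → ℝ, Continuous θ ∧
    (∀ ψ, 0 < r ψ ∧ x ψ = a + r ψ * cos (θ ψ) ∧ y ψ = b - r ψ * sin (θ ψ)) ∧
    θ (2 * π) - θ 0 = 2 * π * n

/-- The index of a solution `φ` is `n`: the class of the curve `(φ, dφ/dt)`, `t = T ψ / (2π)`, in
`π₁(ℝ² ∖ {(φ₊(α), 0)}) ≃ ℤ`. -/
def LichSolution.HasIndex {T R β α : ℝ} (φ : LichSolution T R β α) (n : ℤ) : Prop :=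
  WindsClockwise φ.1 (fun ψ => 2 * π / T * deriv φ.1 ψ) (phiPlus T R β α) 0 n

/-- `α_max = 2 R^{3/2} / (3 √3 β²)`. -/
noncomputable def alphaMax (R β : ℝ) : ℝ := 2 / (3 * √3 * β ^ 2) * R ^ (3 / 2 : ℝ)

/-- `α_{k,+}`; moreover `α_{k,-} = -α_{k,+}`. Used only when `2 (2π/T)² k² < R`. -/
noncomputable def alphaPlus (T R β : ℝ) (k : ℕ) : ℝ :=
  2 / (3 * √3 * β ^ 2) * (R + (2 * π / T) ^ 2 * (k : ℝ) ^ 2) *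
    √(R - 2 * (2 * π / T) ^ 2 * (k : ℝ) ^ 2)

/-- `α_{k,-}`. -/
noncomputable def alphaMinus (T R β : ℝ) (k : ℕ) : ℝ := -alphaPlus T R β k

/-- `(α_{k,-}, α_{k+1,-}] ∪ [α_{k+1,+}, α_{k,+})` if `k < kmax`, and `(α_{k,-}, α_{k,+})` if
`k = kmax`. -/
def alphaRange (T R β : ℝ) (kmax k : ℕ) : Set ℝ :=
  {α | (k < kmax ∧
      α ∈ Set.Ioc (alphaMinus T R β k) (alphaMinus T R β (k + 1)) ∪
        Set.Ico (alphaPlus T R β (k + 1)) (alphaPlus T R β k)) ∨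
    (k = kmax ∧ α ∈ Set.Ioo (alphaMinus T R β k) (alphaPlus T R β k))}

/-! The equation is a Newton equation φ'' = -f(φ), and with v = φ⁴ the sign of f is that of α² -
v²(R - β²v). On v > 0 this cubic has maximum α_max², at v = 2R/(3β²). If |α| ≥ α_max, then f ≥ 0
along any solution, so φ is concave and periodic, hence constant; this leaves no solution, or the
one at the double root.

For 0 < |α| < α_max there are an unstable equilibrium m and a stable one c > m. Let X be the signed
square root of twice the potential relative to c. Energy conservation reads φ'² + X(φ)² = r², so
(X(φ), φ') = r(cos θ, -sin θ), and with N = (X')⁻² the period is P(r) = ∫₀^{2π} √N(X⁻¹(r cos s)) ds.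
Pairing s with s + π shows that P is strictly increasing when N' is (Chicone's criterion,
`period_strictMonoOn`). It starts at P(0) = 2π√N(c) and is unbounded, because motion near m is
exponentially slow (`exists_lt_period`). Hence nP(r) = 2π has a solution r exactly when n√N(c) < 1,
and then only one. Every non-constant solution is a translate of such an orbit (`exists_eq_orbit`),
and n is its winding number (`orbit_windsClockwise`).

It remains to verify Chicone's criterion and to evaluate N(c). Rescaling c to 1 leaves one parameter
0 < l < 1/2, and N'' > 0 becomes positivity of the polynomial `lichE`, proved by expansions with
nonnegative coefficients. Finally n√N(c) < 1 says that v = c⁴ exceeds `bifurcationValue` n; the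
cubic decreases on this branch, so the intervals in α are the intervals between consecutive
bifurcation values. -/

/-- A periodic function with antitone derivative is constant. -/
theorem eq_of_periodic_of_antitone_deriv {φ φ' : ℝ → ℝ} {p : ℝ} (hp : 0 < p)
    (hφ : ∀ t, HasDerivAt φ (φ' t) t) (hper : Function.Periodic φ p) (hanti : Antitone φ')
    (s t : ℝ) : φ s = φ t := by
  have hper' : Function.Periodic φ' p := fun t => by
    have h1 : HasDerivAt (fun x => φ (x + p)) (φ' (t + p)) t := (hφ (t + p)).comp_add_const t p
    have h2 : (fun x => φ (x + p)) = φ := funext hper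
    rw [h2] at h1
    exact h1.unique (hφ t)
  -- Translating t or 0 by whole periods puts either one to the right of the other, so antitonicity
  -- gives both inequalities.
  have hconst : ∀ t, φ' t = φ' 0 := by
    intro t
    apply le_antisymm
    · obtain ⟨n, hn⟩ := exists_nat_gt (-t / p)
      have : 0 ≤ t + n * p := by
        rw [div_lt_iff₀ hp] at hn; linarith
      have h3 := hanti this
      rwa [(hper'.nat_mul n) t] at h3
    · obtain ⟨n, hn⟩ := exists_nat_gt (t / p)
      have : t ≤ 0 + n * p := by
        rw [div_lt_iff₀ hp] at hn; linarith
      have h3 := hanti this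
      rwa [(hper'.nat_mul n) 0] at h3
  have hlin : ∀ t, φ t - φ' 0 * t = φ 0 - φ' 0 * 0 := fun t =>
    is_const_of_deriv_eq_zero (f := fun t => φ t - φ' 0 * t)
      (fun t => ((hφ t).sub ((hasDerivAt_id t).const_mul _)).differentiableAt)
      (fun t => by
        have := ((hφ t).sub ((hasDerivAt_id t).const_mul (φ' 0))).deriv
        rw [hconst t] at this
        exact this.trans (by ring)) t 0
  have h0 : φ' 0 = 0 := by
    have h1 := hlin p
    have h2 := hper 0
    rw [zero_add] at h2
    rw [h2] at h1
    have : φ' 0 * p = 0 := by linarith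
    exact (mul_eq_zero.1 this).resolve_right hp.ne'
  have h1 := hlin s
  have h2 := hlin t
  rw [h0] at h1 h2
  linarith

/-- Uniqueness for the autonomous second order equation `φ'' = -f(φ)`. -/
theorem second_order_ode_unique {f : ℝ → ℝ} {S : Set ℝ} {K : NNReal} (hf : LipschitzOnWith K f S)
    {φ φ' χ χ' : ℝ → ℝ} (hφ : ∀ t, HasDerivAt φ (φ' t) t)
    (hφ' : ∀ t, HasDerivAt φ' (-f (φ t)) t) (hφS : ∀ t, φ t ∈ S)
    (hχ : ∀ t, HasDerivAt χ (χ' t) t)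
    (hχ' : ∀ t, HasDerivAt χ' (-f (χ t)) t) (hχS : ∀ t, χ t ∈ S) {t₀ : ℝ}
    (h0 : φ t₀ = χ t₀) (h1 : φ' t₀ = χ' t₀) : φ = χ := by
  have hv : LipschitzOnWith (max 1 K) (fun p : ℝ × ℝ => (p.2, -f p.1)) (S ×ˢ Set.univ) := by
    have h2 : LipschitzOnWith 1 (fun p : ℝ × ℝ => p.2) (S ×ˢ Set.univ) :=
      LipschitzWith.prod_snd.lipschitzOnWith
    have h3 : LipschitzOnWith K (fun p : ℝ × ℝ => -f p.1) (S ×ˢ Set.univ) := by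
      have := (hf.comp (LipschitzWith.prod_fst.lipschitzOnWith (s := S ×ˢ (Set.univ : Set ℝ)))
        (fun p hp => hp.1))
      rw [mul_one] at this
      exact this.neg
    exact h2.prodMk h3
  have := ODE_solution_unique_univ (v := fun _ p => (p.2, -f p.1))
    (s := fun _ => S ×ˢ Set.univ) (f := fun t => (φ t, φ' t)) (g := fun t => (χ t, χ' t))
    (t₀ := t₀) (fun _ => hv)
    (fun t => ⟨(hφ t).prodMk (hφ' t), hφS t, trivial⟩)
    (fun t => ⟨(hχ t).prodMk (hχ' t), hχS t, trivial⟩) (by simp [h0, h1])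
  funext t
  exact congrArg Prod.fst (congrFun this t)

/-- The winding number of a curve is well defined. -/
theorem WindsClockwise.unique {x y : ℝ → ℝ} {a b : ℝ} {n k : ℤ} (hn : WindsClockwise x y a b n)
    (hk : WindsClockwise x y a b k) : n = k := by
  obtain ⟨r₁, θ₁, hc₁, h₁, e₁⟩ := hn
  obtain ⟨r₂, θ₂, hc₂, h₂, e₂⟩ := hk
  have key : ∀ t, ∃ j : ℤ, (θ₁ t - θ₂ t) / (2 * π) = j := by
    intro t
    obtain ⟨p1, x1, y1⟩ := h₁ t
    obtain ⟨p2, x2, y2⟩ := h₂ t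
    have hx : r₁ t * cos (θ₁ t) = r₂ t * cos (θ₂ t) := by linarith
    have hy : r₁ t * sin (θ₁ t) = r₂ t * sin (θ₂ t) := by linarith
    have hr : r₁ t = r₂ t := by
      have : r₁ t ^ 2 = r₂ t ^ 2 := by
        have e1 : r₁ t ^ 2 = (r₁ t * cos (θ₁ t)) ^ 2 + (r₁ t * sin (θ₁ t)) ^ 2 := by
          rw [mul_pow, mul_pow, ← mul_add, cos_sq_add_sin_sq, mul_one]
        rw [e1, hx, hy, mul_pow, mul_pow, ← mul_add, cos_sq_add_sin_sq, mul_one]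
      exact (pow_left_inj₀ p1.le p2.le two_ne_zero).1 this
    rw [hr] at hx hy
    have hx' := mul_left_cancel₀ p2.ne' hx
    have hy' := mul_left_cancel₀ p2.ne' hy
    have : cos (θ₁ t - θ₂ t) = 1 := by
      rw [cos_sub, hx', hy', ← sq, ← sq, cos_sq_add_sin_sq]
    obtain ⟨j, hj⟩ := (cos_eq_one_iff _).1 this
    exact ⟨j, by rw [← hj]; field_simp⟩
  choose j hj using key
  -- The two angle lifts differ by an integer number of turns; a continuous integer-valued function
  -- on ℝ is constant, so both lifts gain the same amount.
  have hcj : Continuous j := by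
    rw [Int.isClosedEmbedding_coe_real.isEmbedding.continuous_iff]
    have : (Int.cast ∘ j : ℝ → ℝ) = fun t => (θ₁ t - θ₂ t) / (2 * π) := funext fun t => (hj t).symm
    rw [this]
    fun_prop
  have h := PreconnectedSpace.constant (f := j) inferInstance hcj (x := 2 * π) (y := 0)
  have h3 : (θ₁ (2 * π) - θ₂ (2 * π)) / (2 * π) = (θ₁ 0 - θ₂ 0) / (2 * π) := by
    rw [hj, hj, h]
  have hpi := Real.pi_pos
  have h4 : θ₁ (2 * π) - θ₂ (2 * π) = θ₁ 0 - θ₂ 0 := by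
    field_simp at h3; linarith
  have h5 : 2 * π * (n : ℝ) = 2 * π * k := by rw [← e₁, ← e₂]; linarith
  exact_mod_cast mul_left_cancel₀ (by positivity) h5

/-- A closed curve that stays in the open half plane of a uniformly turning direction winds as
often as that direction. -/
theorem WindsClockwise.of_inner_pos {x y θ : ℝ → ℝ} {a b : ℝ} {n : ℤ} (hx : Continuous x)
    (hy : Continuous y) (hθ : Continuous θ) (hxp : x (2 * π) = x 0) (hyp : y (2 * π) = y 0)
    (hn : θ (2 * π) - θ 0 = 2 * π * n)
    (hpos : ∀ t, 0 < (x t - a) * cos (θ t) - (y t - b) * sin (θ t)) :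
    WindsClockwise x y a b n := by
  -- `d` and `e` are the coordinates of (x - a, -(y - b)) in the orthonormal frame turned by θ.
  -- Since `d > 0`, the angle relative to the frame is arctan(e/d), which is continuous and equal at
  -- both ends.
  set d : ℝ → ℝ := fun t => (x t - a) * cos (θ t) - (y t - b) * sin (θ t) with hd
  set e : ℝ → ℝ := fun t => -(x t - a) * sin (θ t) - (y t - b) * cos (θ t) with he
  have hdc : Continuous d := by fun_prop
  have hec : Continuous e := by fun_prop
  refine ⟨fun t => d t * √(1 + (e t / d t) ^ 2), fun t => θ t + arctan (e t / d t), ?_, ?_, ?_⟩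
  · exact hθ.add (continuous_arctan.comp (hec.div hdc fun t => (hpos t).ne'))
  · intro t
    have hdt : 0 < d t := hpos t
    have hs : 0 < √(1 + (e t / d t) ^ 2) := Real.sqrt_pos.2 (by positivity)
    have hcs := sin_sq_add_cos_sq (θ t)
    have hC : d t * √(1 + (e t / d t) ^ 2) * cos (arctan (e t / d t)) = d t := by
      rw [cos_arctan]; field_simp
    have hS : d t * √(1 + (e t / d t) ^ 2) * sin (arctan (e t / d t)) = e t := by
      rw [sin_arctan]; field_simp
    refine ⟨by positivity, ?_, ?_⟩
    · rw [cos_add, mul_sub, mul_left_comm, hC, mul_left_comm, hS]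
      simp only [hd, he]
      linear_combination (-(x t - a)) * hcs
    · rw [sin_add, mul_add, mul_left_comm, hC, mul_left_comm, hS]
      simp only [hd, he]
      linear_combination (-(y t - b)) * hcs
  · have h1 : cos (θ (2 * π)) = cos (θ 0) := by
      rw [show θ (2 * π) = θ 0 + n * (2 * π) by linarith, cos_add_int_mul_two_pi]
    have h2 : sin (θ (2 * π)) = sin (θ 0) := by
      rw [show θ (2 * π) = θ 0 + n * (2 * π) by linarith, sin_add_int_mul_two_pi]
    simp only [hd, he, h1, h2, hxp, hyp]
    linarith

/-! ### Potential wells and monotonicity of the period function -/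

/-- A one-well force law `f` on `(0, ∞)` with unstable equilibrium `m` and stable equilibrium `c`.
The function `X` is the signed square root of twice the potential energy relative to `c`, and
`N = (X')⁻²`; strict monotonicity of `N'` is Chicone's criterion. -/
structure PotentialWell (m c : ℝ) (f X N N' : ℝ → ℝ) : Prop where
  pos : 0 < m
  lt : m < c
  X_continuousOn : ContinuousOn X (Set.Ici m)
  X_center : X c = 0
  X_hasDerivAt : ∀ u, m < u → HasDerivAt X (1 / √(N u)) u
  N_pos : ∀ u, m < u → 0 < N u
  N_hasDerivAt : ∀ u, m < u → HasDerivAt N (N' u) u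
  N'_strictMonoOn : StrictMonoOn N' (Set.Ioi m)
  force_eq : ∀ u, m < u → f u = X u / √(N u)
  exists_neg_le : ∃ M, m < M ∧ -X m ≤ X M
  force_m : f m = 0
  force_pos : ∀ u, 0 < u → u < m → 0 < f u
  force_contDiffOn : ContDiffOn ℝ 1 f (Set.Ioi 0)

theorem exists_lipschitzOnWith_Icc {f : ℝ → ℝ} (hf : ContDiffOn ℝ 1 f (Set.Ioi 0)) {a b : ℝ}
    (ha : 0 < a) : ∃ K, LipschitzOnWith K f (Set.Icc a b) := by
  have hsub : Set.Icc a b ⊆ Set.Ioi 0 := fun x hx => ha.trans_le hx.1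
  obtain ⟨C, hC⟩ := isCompact_Icc.exists_bound_of_continuousOn
    ((hf.continuousOn_deriv_of_isOpen isOpen_Ioi le_rfl).mono hsub)
  refine ⟨C.toNNReal, Convex.lipschitzOnWith_of_nnnorm_deriv_le (fun x hx => ?_) (fun x hx => ?_)
    (convex_Icc a b)⟩
  · exact (hf.differentiableOn one_ne_zero).differentiableAt (isOpen_Ioi.mem_nhds (hsub hx))
  · rw [← NNReal.coe_le_coe, coe_nnnorm]
    exact (hC x hx).trans (le_coe_toNNReal C)

/-- The inverse of `X` on `(m, ∞)`. -/
noncomputable def wellInv (m : ℝ) (X : ℝ → ℝ) : ℝ → ℝ := Function.invFunOn X (Set.Ioi m)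

/-- The derivative of the inverse of `X`. -/
noncomputable def wellSlope (m : ℝ) (X N : ℝ → ℝ) (y : ℝ) : ℝ := √(N (wellInv m X y))

/-- The time at which the orbit of amplitude `r` reaches the angle `θ`. -/
noncomputable def wellTime (m : ℝ) (X N : ℝ → ℝ) (r θ : ℝ) : ℝ :=
  ∫ s in (0)..θ, wellSlope m X N (r * cos s)

/-- The period of the orbit of amplitude `r`. -/
noncomputable def wellPeriod (m : ℝ) (X N : ℝ → ℝ) (r : ℝ) : ℝ := wellTime m X N r (2 * π)

namespace PotentialWell

variable {m c : ℝ} {f X N N' : ℝ → ℝ}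

theorem strictMonoOn (W : PotentialWell m c f X N N') : StrictMonoOn X (Set.Ici m) := by
  apply strictMonoOn_of_deriv_pos (convex_Ici m) W.X_continuousOn
  intro u hu
  rw [interior_Ici] at hu
  rw [(W.X_hasDerivAt u hu).deriv]
  have := sqrt_pos.2 (W.N_pos u hu)
  positivity

theorem X_m_neg (W : PotentialWell m c f X N N') : X m < 0 := by
  have := W.strictMonoOn (Set.self_mem_Ici) (Set.mem_Ici.2 W.lt.le) W.lt
  rwa [W.X_center] at this

/-- By `exists_neg_le` the right wall is at least as high as the rim at m, so the intermediate value
theorem reaches a whole symmetric interval; -X m is the limiting amplitude of closed orbits. -/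
theorem exists_preimage (W : PotentialWell m c f X N N') {y : ℝ} (hy : y ∈ Set.Ioo (X m) (-X m)) :
    ∃ u ∈ Set.Ioi m, X u = y := by
  obtain ⟨M, hM, hXM⟩ := W.exists_neg_le
  obtain ⟨u, hu, rfl⟩ := intermediate_value_Ioo hM.le
    (W.X_continuousOn.mono Set.Icc_subset_Ici_self) ⟨hy.1, hy.2.trans_le hXM⟩
  exact ⟨u, hu.1, rfl⟩

theorem lt_inv (W : PotentialWell m c f X N N') {y : ℝ} (hy : y ∈ Set.Ioo (X m) (-X m)) :
    m < wellInv m X y :=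
  Function.invFunOn_mem (W.exists_preimage hy)

theorem X_inv (W : PotentialWell m c f X N N') {y : ℝ} (hy : y ∈ Set.Ioo (X m) (-X m)) :
    X (wellInv m X y) = y :=
  Function.invFunOn_eq (W.exists_preimage hy)

theorem inv_X (W : PotentialWell m c f X N N') {u : ℝ} (hu : m < u) : wellInv m X (X u) = u :=
  (W.strictMonoOn.mono Set.Ioi_subset_Ici_self).injOn.leftInvOn_invFunOn hu

theorem inv_zero (W : PotentialWell m c f X N N') : wellInv m X 0 = c := by
  rw [← W.X_center, W.inv_X W.lt]

theorem inv_strictMonoOn (W : PotentialWell m c f X N N') :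
    StrictMonoOn (wellInv m X) (Set.Ioo (X m) (-X m)) := by
  intro y hy z hz hyz
  have := W.strictMonoOn.lt_iff_lt (W.lt_inv hy).le (W.lt_inv hz).le
  rw [W.X_inv hy, W.X_inv hz] at this
  exact this.1 hyz

theorem inv_continuousAt (W : PotentialWell m c f X N N') {y : ℝ}
    (hy : y ∈ Set.Ioo (X m) (-X m)) : ContinuousAt (wellInv m X) y := by
  apply W.inv_strictMonoOn.continuousAt_of_image_mem_nhds (isOpen_Ioo.mem_nhds hy)
  have h1 : ContinuousAt X (wellInv m X y) := (W.X_hasDerivAt _ (W.lt_inv hy)).continuousAt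
  have h2 : X ⁻¹' (Set.Ioo (X m) (-X m)) ∈ nhds (wellInv m X y) :=
    h1 (by rw [W.X_inv hy]; exact isOpen_Ioo.mem_nhds hy)
  filter_upwards [h2, isOpen_Ioi.mem_nhds (W.lt_inv hy)] with u hu hmu
  exact ⟨X u, hu, W.inv_X hmu⟩

theorem slope_pos (W : PotentialWell m c f X N N') {y : ℝ} (hy : y ∈ Set.Ioo (X m) (-X m)) :
    0 < wellSlope m X N y :=
  sqrt_pos.2 (W.N_pos _ (W.lt_inv hy))

theorem inv_hasDerivAt (W : PotentialWell m c f X N N') {y : ℝ}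
    (hy : y ∈ Set.Ioo (X m) (-X m)) : HasDerivAt (wellInv m X) (wellSlope m X N y) y := by
  have hs := W.slope_pos hy
  have := HasDerivAt.of_local_left_inverse (W.inv_continuousAt hy) (W.X_hasDerivAt _ (W.lt_inv hy))
    (by simpa [wellSlope] using hs.ne') (by
      filter_upwards [isOpen_Ioo.mem_nhds hy] with z hz using W.X_inv hz)
  simpa [wellSlope] using this

/-- The derivative of the inverse is the slope itself, which cancels the denominator coming from √N.
This is why the criterion can be stated on `N'` alone. -/
theorem slope_hasDerivAt (W : PotentialWell m c f X N N') {y : ℝ}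
    (hy : y ∈ Set.Ioo (X m) (-X m)) :
    HasDerivAt (wellSlope m X N) (N' (wellInv m X y) / 2) y := by
  have hs := W.slope_pos hy
  have h1 := (W.N_hasDerivAt _ (W.lt_inv hy)).comp y (W.inv_hasDerivAt hy)
  have h2 := h1.sqrt (W.N_pos _ (W.lt_inv hy)).ne'
  refine h2.congr_deriv ?_
  have : √((N ∘ wellInv m X) y) = wellSlope m X N y := rfl
  rw [this]
  field_simp

theorem slope_continuousOn (W : PotentialWell m c f X N N') :
    ContinuousOn (wellSlope m X N) (Set.Ioo (X m) (-X m)) :=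
  fun _ hy => (W.slope_hasDerivAt hy).continuousAt.continuousWithinAt

theorem neg_mem {a y : ℝ} (hy : y ∈ Set.Ioo a (-a)) : -y ∈ Set.Ioo a (-a) :=
  ⟨by linarith [hy.2], by linarith [hy.1]⟩

/-- Chicone's criterion enters here: the derivative is half the difference of `N'` at the preimages
of y and -y, which are ordered. -/
theorem slope_add_slope_neg_strictMonoOn (W : PotentialWell m c f X N N') :
    StrictMonoOn (fun y => wellSlope m X N y + wellSlope m X N (-y)) (Set.Ico 0 (-X m)) := by
  have hsub : ∀ y ∈ Set.Ico 0 (-X m), y ∈ Set.Ioo (X m) (-X m) := fun y hy =>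
    ⟨W.X_m_neg.trans_le hy.1, hy.2⟩
  have hd : ∀ y ∈ Set.Ico 0 (-X m), HasDerivAt (fun y => wellSlope m X N y + wellSlope m X N (-y))
      (N' (wellInv m X y) / 2 + N' (wellInv m X (-y)) / 2 * (-1)) y := fun y hy =>
    (W.slope_hasDerivAt (hsub y hy)).add
      ((W.slope_hasDerivAt (neg_mem (hsub y hy))).comp y (hasDerivAt_neg y))
  apply strictMonoOn_of_deriv_pos (convex_Ico _ _)
    (fun y hy => (hd y hy).continuousAt.continuousWithinAt)
  intro y hy
  rw [interior_Ico] at hy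
  have hy' := Set.Ioo_subset_Ico_self hy
  rw [(hd y hy').deriv]
  have hI := hsub y hy'
  have := W.N'_strictMonoOn (W.lt_inv (neg_mem hI)) (W.lt_inv hI)
    (W.inv_strictMonoOn (neg_mem hI) hI (by linarith [hy.1]))
  linarith

theorem mul_cos_mem {a r : ℝ} (h0 : 0 ≤ r) (hr : r < -a) (s : ℝ) :
    r * cos s ∈ Set.Ioo a (-a) := by
  have h1 := abs_le.1 (abs_cos_le_one s)
  constructor <;> nlinarith [h1.1, h1.2]

theorem slope_cos_continuous (W : PotentialWell m c f X N N') {r : ℝ} (h0 : 0 ≤ r)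
    (hr : r < -X m) : Continuous fun s => wellSlope m X N (r * cos s) :=
  W.slope_continuousOn.comp_continuous (by fun_prop) (mul_cos_mem h0 hr)

theorem slope_cos_periodic (r : ℝ) :
    Function.Periodic (fun s => wellSlope m X N (r * cos s)) (2 * π) := fun s => by
  simp only [cos_add_two_pi]

theorem time_hasDerivAt (W : PotentialWell m c f X N N') {r : ℝ} (h0 : 0 ≤ r) (hr : r < -X m)
    (θ : ℝ) : HasDerivAt (wellTime m X N r) (wellSlope m X N (r * cos θ)) θ :=
  intervalIntegral.integral_hasDerivAt_right
    ((W.slope_cos_continuous h0 hr).intervalIntegrable _ _)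
    (W.slope_cos_continuous h0 hr).aestronglyMeasurable.stronglyMeasurableAtFilter
    (W.slope_cos_continuous h0 hr).continuousAt

theorem time_strictMono (W : PotentialWell m c f X N N') {r : ℝ} (h0 : 0 ≤ r) (hr : r < -X m) :
    StrictMono (wellTime m X N r) := by
  apply strictMono_of_deriv_pos
  intro θ
  rw [(W.time_hasDerivAt h0 hr θ).deriv]
  exact W.slope_pos (mul_cos_mem h0 hr θ)

theorem time_zero (r : ℝ) : wellTime m X N r 0 = 0 := intervalIntegral.integral_same

theorem time_add_two_pi (W : PotentialWell m c f X N N') {r : ℝ} (h0 : 0 ≤ r) (hr : r < -X m)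
    (θ : ℝ) : wellTime m X N r (θ + 2 * π) = wellTime m X N r θ + wellPeriod m X N r := by
  have h := (slope_cos_periodic (m := m) (X := X) (N := N) r).intervalIntegral_add_eq_add 0 θ
    (fun _ _ => (W.slope_cos_continuous h0 hr).intervalIntegrable _ _)
  simpa [wellTime, wellPeriod] using h

theorem time_surjective (W : PotentialWell m c f X N N') {r : ℝ} (h0 : 0 ≤ r) (hr : r < -X m) :
    Function.Surjective (wellTime m X N r) := by
  have hper := slope_cos_periodic (m := m) (X := X) (N := N) r
  have hint : IntervalIntegrable (fun s => wellSlope m X N (r * cos s)) MeasureTheory.volume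
    0 (2 * π) := (W.slope_cos_continuous h0 hr).intervalIntegrable _ _
  have hpos : ∀ s, 0 < wellSlope m X N (r * cos s) := fun s => W.slope_pos (mul_cos_mem h0 hr s)
  exact (continuous_iff_continuousAt.2 fun θ => (W.time_hasDerivAt h0 hr θ).continuousAt).surjective
    (hper.tendsto_atTop_intervalIntegral_of_pos' hint hpos two_pi_pos)
    (hper.tendsto_atBot_intervalIntegral_of_pos' hint hpos two_pi_pos)

/-- Amplitude 0 encodes the period of the linearisation at c, the limit of small oscillations. -/
theorem period_zero (W : PotentialWell m c f X N N') : wellPeriod m X N 0 = 2 * π * √(N c) := by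
  simp [wellPeriod, wellTime, wellSlope, W.inv_zero]

/-- Shifting s by π preserves the integral and turns r cos s into its negative; adding the two
copies symmetrises the integrand. -/
theorem two_mul_period (W : PotentialWell m c f X N N') {r : ℝ} (h0 : 0 ≤ r) (hr : r < -X m) :
    2 * wellPeriod m X N r =
      ∫ s in (0)..(2 * π), (wellSlope m X N (|r * cos s|) + wellSlope m X N (-|r * cos s|)) := by
  have h1 : ∀ s, wellSlope m X N (|r * cos s|) + wellSlope m X N (-|r * cos s|) =
      wellSlope m X N (r * cos s) + wellSlope m X N (r * cos (s + π)) := by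
    intro s
    rw [cos_add_pi, mul_neg]
    rcases abs_cases (r * cos s) with ⟨h, -⟩ | ⟨h, -⟩
    · rw [h]
    · rw [h, neg_neg, add_comm]
  have hc := W.slope_cos_continuous h0 hr
  have hc' : Continuous fun s => wellSlope m X N (r * cos (s + π)) :=
    hc.comp (continuous_add_const π)
  simp only [h1]
  rw [intervalIntegral.integral_add (hc.intervalIntegrable _ _) (hc'.intervalIntegrable _ _),
    intervalIntegral.integral_comp_add_right (fun s => wellSlope m X N (r * cos s)),
    zero_add, add_comm (2 * π) π,
    (slope_cos_periodic (m := m) (X := X) (N := N) r).intervalIntegral_add_eq π 0, zero_add,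
    two_mul]
  rfl

/-- The symmetrised integrand depends on |r cos s|, which grows with r; at s = 0 the growth is
strict. -/
theorem period_strictMonoOn (W : PotentialWell m c f X N N') :
    StrictMonoOn (wellPeriod m X N) (Set.Ico 0 (-X m)) := by
  intro r hr q hq hrq
  have key : 2 * wellPeriod m X N r < 2 * wellPeriod m X N q := by
    rw [W.two_mul_period hr.1 hr.2, W.two_mul_period hq.1 hq.2]
    have hcont : ∀ r ∈ Set.Ico 0 (-X m), Continuous fun s =>
        wellSlope m X N (|r * cos s|) + wellSlope m X N (-|r * cos s|) := by
      intro r hr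
      have hmem : ∀ s, |r * cos s| ∈ Set.Ioo (X m) (-X m) := fun s => by
        have := mul_cos_mem hr.1 hr.2 s
        exact ⟨W.X_m_neg.trans_le (abs_nonneg _), abs_lt.2 ⟨by linarith [this.1], this.2⟩⟩
      exact (W.slope_continuousOn.comp_continuous (by fun_prop) hmem).add
        (W.slope_continuousOn.comp_continuous (by fun_prop) fun s => neg_mem (hmem s))
    have hIco : ∀ r ∈ Set.Ico 0 (-X m), ∀ s, |r * cos s| ∈ Set.Ico 0 (-X m) := by
      intro r hr s
      have := mul_cos_mem hr.1 hr.2 s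
      exact ⟨abs_nonneg _, abs_lt.2 ⟨by linarith [this.1], this.2⟩⟩
    apply intervalIntegral.integral_lt_integral_of_continuousOn_of_le_of_exists_lt two_pi_pos
      (hcont r hr).continuousOn (hcont q hq).continuousOn
    · intro s _
      apply W.slope_add_slope_neg_strictMonoOn.monotoneOn (hIco r hr s) (hIco q hq s)
      rw [abs_mul, abs_mul, abs_of_nonneg hr.1, abs_of_nonneg hq.1]
      gcongr
    · refine ⟨0, ⟨le_rfl, two_pi_pos.le⟩, ?_⟩
      apply W.slope_add_slope_neg_strictMonoOn (hIco r hr 0) (hIco q hq 0)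
      simpa [abs_of_nonneg hr.1, abs_of_nonneg hq.1] using hrq
  linarith

theorem period_continuousOn (W : PotentialWell m c f X N N') {q : ℝ} (hq0 : 0 ≤ q)
    (hq : q < -X m) : ContinuousOn (wellPeriod m X N) (Set.Icc 0 q) := by
  -- Clamping the argument to [-q, q] makes the integrand globally continuous; for r ≤ q the clamp
  -- is inactive.
  set g : ℝ → ℝ := fun y => wellSlope m X N (max (-q) (min q y)) with hg
  have hgc : Continuous g := W.slope_continuousOn.comp_continuous (by fun_prop) fun y =>
    ⟨lt_max_of_lt_left (by linarith), max_lt (by linarith) ((min_le_left _ _).trans_lt hq)⟩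
  have hP : Continuous fun r : ℝ => ∫ s in (0)..(2 * π), g (r * cos s) :=
    intervalIntegral.continuous_parametric_intervalIntegral_of_continuous' (by fun_prop) _ _
  refine hP.continuousOn.congr fun r hr => ?_
  simp only [wellPeriod, wellTime]
  congr 1
  funext s
  have h1 := abs_le.1 (abs_cos_le_one s)
  rw [hg]
  simp only
  rw [min_eq_right (by nlinarith [h1.1, h1.2, hr.1, hr.2]),
    max_eq_right (by nlinarith [h1.1, h1.2, hr.1, hr.2])]

end PotentialWell

/-! ### Orbits of the well and the range of the period -/

/-- The angle of the orbit of amplitude `r` at time `t`. -/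
noncomputable def wellAngle (m : ℝ) (X N : ℝ → ℝ) (r : ℝ) : ℝ → ℝ :=
  Function.invFun (wellTime m X N r)

/-- The solution of amplitude `r` that is at its maximum at time `0`. -/
noncomputable def wellOrbit (m : ℝ) (X N : ℝ → ℝ) (r t : ℝ) : ℝ :=
  wellInv m X (r * cos (wellAngle m X N r t))

namespace PotentialWell

variable {m c : ℝ} {f X N N' : ℝ → ℝ}

/-- The force vanishes at m and is Lipschitz, so (X²)' = 2f ≥ -2K(u - m). Hence the speed of an
orbit below the rim energy is at most C(u - m). -/
theorem exists_barrier (W : PotentialWell m c f X N N') :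
    ∃ C, 0 < C ∧ ∀ u ∈ Set.Icc m c, X m ^ 2 - X u ^ 2 ≤ C ^ 2 * (u - m) ^ 2 := by
  obtain ⟨K, hK⟩ := exists_lipschitzOnWith_Icc W.force_contDiffOn W.pos (b := c)
  have hK0 : (0 : ℝ) < K + 1 := by positivity
  refine ⟨√(K + 1), sqrt_pos.2 hK0, fun u hu => ?_⟩
  rw [sq_sqrt hK0.le]
  have hmono : MonotoneOn (fun u => X u ^ 2 + (K + 1) * (u - m) ^ 2) (Set.Icc m c) := by
    apply monotoneOn_of_deriv_nonneg (convex_Icc m c)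
    · exact ((W.X_continuousOn.mono Set.Icc_subset_Ici_self).pow 2).add (by fun_prop)
    · intro u hu
      rw [interior_Icc] at hu
      exact (((W.X_hasDerivAt u hu.1).differentiableAt.pow 2).add
        (by fun_prop)).differentiableWithinAt
    · intro u hu
      rw [interior_Icc] at hu
      have h1 := ((W.X_hasDerivAt u hu.1).pow 2).add
        ((((hasDerivAt_id u).sub_const m).pow 2).const_mul (K + 1 : ℝ))
      have h2 : HasDerivAt (fun u => X u ^ 2 + (K + 1) * (u - m) ^ 2)
          (2 * f u + 2 * (K + 1) * (u - m)) u := by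
        refine h1.congr_deriv ?_
        rw [W.force_eq u hu.1]
        simp
        ring
      rw [h2.deriv]
      have h3 := hK.dist_le_mul u ⟨hu.1.le, hu.2.le⟩ m ⟨le_rfl, W.lt.le⟩
      rw [W.force_m, dist_zero_right, Real.dist_eq, abs_of_pos (sub_pos.2 hu.1)] at h3
      have h4 := neg_abs_le (f u)
      rw [Real.norm_eq_abs] at h3
      nlinarith [hu.1]
  have := hmono ⟨le_rfl, W.lt.le⟩ hu hu.1
  simp only [sub_self] at this
  linarith

/-- By the barrier, log(φ - m) decreases at rate at most C, so an orbit whose left turning point is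
exponentially close to m needs a long time to get there from c. -/
theorem exists_lt_period (W : PotentialWell m c f X N N') (A : ℝ) :
    ∃ r ∈ Set.Ioo 0 (-X m), A < wellPeriod m X N r := by
  obtain ⟨C, hC, hbar⟩ := W.exists_barrier
  have hcm := sub_pos.2 W.lt
  set B := |A| + 1 with hB
  have hBpos : 0 < B := by positivity
  -- The left turning point, chosen so that log(u - m) lies C·B below log(c - m).
  set u := m + (c - m) * exp (-(C * B)) with hu
  have hexp : exp (-(C * B)) < 1 := by
    rw [exp_lt_one_iff]
    have := mul_pos hC hBpos
    linarith
  have hmu : m < u := by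
    have := mul_pos hcm (exp_pos (-(C * B)))
    linarith
  have huc : u < c := by
    have := mul_lt_mul_of_pos_left hexp hcm
    linarith
  have hXu : X u < 0 := by
    have := W.strictMonoOn hmu.le (Set.mem_Ici.2 W.lt.le) huc
    rwa [W.X_center] at this
  have hXm : X m < X u := W.strictMonoOn Set.self_mem_Ici hmu.le hmu
  set r := -X u with hr
  have hr0 : 0 < r := by linarith
  have hrρ : r < -X m := by linarith
  refine ⟨r, ⟨hr0, hrρ⟩, ?_⟩
  have hd : ∀ s, HasDerivAt
      (fun s => log (wellInv m X (r * cos s) - m) + C * wellTime m X N r s)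
      (wellSlope m X N (r * cos s) * (r * -sin s) / (wellInv m X (r * cos s) - m) +
        C * wellSlope m X N (r * cos s)) s := by
    intro s
    have hI := mul_cos_mem hr0.le hrρ s
    have h1 : HasDerivAt (fun s => wellInv m X (r * cos s))
        (wellSlope m X N (r * cos s) * (r * -sin s)) s :=
      (W.inv_hasDerivAt hI).comp s ((hasDerivAt_cos s).const_mul r)
    exact ((h1.sub_const m).log (sub_pos.2 (W.lt_inv hI)).ne').add
      ((W.time_hasDerivAt hr0.le hrρ s).const_mul C)
  -- Angles from π/2 to π are the passage from c down to u; comparing the ends bounds its duration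
  -- below by B.
  have hmono : MonotoneOn (fun s => log (wellInv m X (r * cos s) - m) + C * wellTime m X N r s)
      (Set.Icc (π / 2) π) := by
    apply monotoneOn_of_deriv_nonneg (convex_Icc _ _)
      (fun s _ => (hd s).continuousAt.continuousWithinAt)
      (fun s _ => (hd s).differentiableAt.differentiableWithinAt)
    intro s hs
    rw [interior_Icc] at hs
    rw [(hd s).deriv]
    have hI := mul_cos_mem hr0.le hrρ s
    have hsl := W.slope_pos hI
    have hm := W.lt_inv hI
    have hm' := sub_pos.2 hm
    have hcos : cos s ≤ 0 := cos_nonpos_of_pi_div_two_le_of_le hs.1.le (by linarith [hs.2, pi_pos])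
    have hc' : wellInv m X (r * cos s) ≤ c := by
      rw [← W.inv_zero]
      exact W.inv_strictMonoOn.monotoneOn hI ⟨W.X_m_neg, by linarith [W.X_m_neg]⟩
        (mul_nonpos_of_nonneg_of_nonpos hr0.le hcos)
    have hb := hbar _ ⟨hm.le, hc'⟩
    rw [W.X_inv hI] at hb
    have hsq : (r * sin s) ^ 2 ≤ (C * (wellInv m X (r * cos s) - m)) ^ 2 := by
      have h2 := sin_sq_add_cos_sq s
      have h3 : r ^ 2 ≤ X m ^ 2 := by nlinarith
      have h4 : (r * sin s) ^ 2 = r ^ 2 - (r * cos s) ^ 2 := by linear_combination r ^ 2 * h2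
      rw [h4, mul_pow]
      linarith
    have hle : r * sin s ≤ C * (wellInv m X (r * cos s) - m) :=
      (le_abs_self _).trans (abs_le_of_sq_le_sq hsq (by positivity))
    have : wellSlope m X N (r * cos s) * (r * -sin s) / (wellInv m X (r * cos s) - m) +
        C * wellSlope m X N (r * cos s) = wellSlope m X N (r * cos s) *
          (C * (wellInv m X (r * cos s) - m) - r * sin s) / (wellInv m X (r * cos s) - m) := by
      field_simp
      ring
    rw [this]
    exact div_nonneg (mul_nonneg hsl.le (by linarith)) hm'.le
  have h1 := hmono ⟨le_rfl, by linarith [pi_pos]⟩ ⟨by linarith [pi_pos], le_rfl⟩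
    (by linarith [pi_pos] : π / 2 ≤ π)
  simp only [cos_pi_div_two, cos_pi, mul_zero, mul_neg, mul_one] at h1
  rw [W.inv_zero, hr, neg_neg, W.inv_X hmu, ← hr] at h1
  have h2 : log (u - m) = log (c - m) - C * B := by
    rw [hu, add_sub_cancel_left, log_mul hcm.ne' (exp_pos _).ne', log_exp]
    ring
  have ht := W.time_strictMono hr0.le hrρ
  have h3 : 0 < wellTime m X N r (π / 2) := by
    rw [← time_zero (m := m) (X := X) (N := N) r]
    exact ht (by linarith [pi_pos])
  have h4 : wellTime m X N r π < wellPeriod m X N r := ht (by linarith [pi_pos])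
  have h5 : B ≤ wellTime m X N r π := by
    apply le_of_mul_le_mul_left _ hC
    have := mul_pos hC h3
    linarith
  have := le_abs_self A
  linarith

theorem angle_time (W : PotentialWell m c f X N N') {r : ℝ} (h0 : 0 ≤ r) (hr : r < -X m) (θ : ℝ) :
    wellAngle m X N r (wellTime m X N r θ) = θ :=
  Function.leftInverse_invFun (W.time_strictMono h0 hr).injective θ

theorem time_angle (W : PotentialWell m c f X N N') {r : ℝ} (h0 : 0 ≤ r) (hr : r < -X m) (t : ℝ) :
    wellTime m X N r (wellAngle m X N r t) = t :=
  Function.rightInverse_invFun (W.time_surjective h0 hr) t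

theorem angle_strictMono (W : PotentialWell m c f X N N') {r : ℝ} (h0 : 0 ≤ r) (hr : r < -X m) :
    StrictMono (wellAngle m X N r) := fun s t hst => by
  rw [← (W.time_strictMono h0 hr).lt_iff_lt, W.time_angle h0 hr, W.time_angle h0 hr]
  exact hst

theorem angle_continuous (W : PotentialWell m c f X N N') {r : ℝ} (h0 : 0 ≤ r) (hr : r < -X m) :
    Continuous (wellAngle m X N r) :=
  (W.angle_strictMono h0 hr).monotone.continuous_of_surjective
    fun θ => ⟨_, W.angle_time h0 hr θ⟩

theorem angle_zero (W : PotentialWell m c f X N N') {r : ℝ} (h0 : 0 ≤ r) (hr : r < -X m) :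
    wellAngle m X N r 0 = 0 := by
  have := W.angle_time h0 hr 0
  rwa [time_zero] at this

theorem angle_add_period (W : PotentialWell m c f X N N') {r : ℝ} (h0 : 0 ≤ r) (hr : r < -X m)
    (t : ℝ) : wellAngle m X N r (t + wellPeriod m X N r) = wellAngle m X N r t + 2 * π := by
  apply (W.time_strictMono h0 hr).injective
  rw [W.time_angle h0 hr, W.time_add_two_pi h0 hr, W.time_angle h0 hr]

theorem angle_add_nat_mul_period (W : PotentialWell m c f X N N') {r : ℝ} (h0 : 0 ≤ r)
    (hr : r < -X m) (n : ℕ) (t : ℝ) :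
    wellAngle m X N r (t + n * wellPeriod m X N r) = wellAngle m X N r t + n * (2 * π) := by
  induction n with
  | zero => simp
  | succ n ih =>
    rw [show t + ((n + 1 : ℕ) : ℝ) * wellPeriod m X N r =
      (t + n * wellPeriod m X N r) + wellPeriod m X N r by push_cast; ring,
      W.angle_add_period h0 hr, ih]
    push_cast
    ring

theorem angle_hasDerivAt (W : PotentialWell m c f X N N') {r : ℝ} (h0 : 0 ≤ r) (hr : r < -X m)
    (t : ℝ) : HasDerivAt (wellAngle m X N r)
      (wellSlope m X N (r * cos (wellAngle m X N r t)))⁻¹ t :=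
  HasDerivAt.of_local_left_inverse (W.angle_continuous h0 hr).continuousAt
    (W.time_hasDerivAt h0 hr _) (W.slope_pos (mul_cos_mem h0 hr _)).ne'
    (Filter.Eventually.of_forall fun t => W.time_angle h0 hr t)

/-- The angular speed is the reciprocal of the slope of the inverse of X, so the two cancel and the
velocity is exactly -r sin θ. -/
theorem orbit_hasDerivAt (W : PotentialWell m c f X N N') {r : ℝ} (h0 : 0 ≤ r) (hr : r < -X m)
    (t : ℝ) : HasDerivAt (wellOrbit m X N r) (-(r * sin (wellAngle m X N r t))) t := by
  have hI := mul_cos_mem h0 hr (wellAngle m X N r t)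
  have h1 := (W.inv_hasDerivAt hI).comp t ((W.angle_hasDerivAt h0 hr t).cos.const_mul r)
  refine h1.congr_deriv ?_
  have := (W.slope_pos hI).ne'
  field_simp

theorem lt_orbit (W : PotentialWell m c f X N N') {r : ℝ} (h0 : 0 ≤ r) (hr : r < -X m)
    (t : ℝ) : m < wellOrbit m X N r t := W.lt_inv (mul_cos_mem h0 hr _)

theorem X_orbit (W : PotentialWell m c f X N N') {r : ℝ} (h0 : 0 ≤ r) (hr : r < -X m)
    (t : ℝ) : X (wellOrbit m X N r t) = r * cos (wellAngle m X N r t) :=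
  W.X_inv (mul_cos_mem h0 hr _)

theorem orbit_deriv_hasDerivAt (W : PotentialWell m c f X N N') {r : ℝ} (h0 : 0 ≤ r)
    (hr : r < -X m) (t : ℝ) :
    HasDerivAt (fun t => -(r * sin (wellAngle m X N r t))) (-f (wellOrbit m X N r t)) t := by
  have h1 := ((W.angle_hasDerivAt h0 hr t).sin.const_mul r).neg
  refine h1.congr_deriv ?_
  rw [W.force_eq _ (W.lt_orbit h0 hr t), W.X_orbit h0 hr t]
  simp only [wellOrbit, wellSlope, div_eq_mul_inv]
  ring

theorem orbit_zero (W : PotentialWell m c f X N N') {r : ℝ} (h0 : 0 ≤ r) (hr : r < -X m) :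
    wellOrbit m X N r 0 = wellInv m X r := by
  simp [wellOrbit, W.angle_zero h0 hr]

theorem orbit_not_const (W : PotentialWell m c f X N N') {r : ℝ} (h0 : 0 < r) (hr : r < -X m) :
    wellOrbit m X N r (wellTime m X N r π) ≠ wellOrbit m X N r 0 := by
  intro h
  have := congrArg X h
  rw [W.X_orbit h0.le hr, W.X_orbit h0.le hr, W.angle_time h0.le hr, W.angle_zero h0.le hr] at this
  simp at this
  linarith

/-- The period increases continuously from its linearised value at amplitude 0 and is unbounded. -/
theorem exists_period_eq_iff (W : PotentialWell m c f X N N') (L : ℝ) :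
    (∃ r ∈ Set.Ioo 0 (-X m), wellPeriod m X N r = L) ↔ 2 * π * √(N c) < L := by
  have hρ : 0 < -X m := neg_pos.2 W.X_m_neg
  constructor
  · rintro ⟨r, hr, rfl⟩
    rw [← W.period_zero]
    exact W.period_strictMonoOn ⟨le_rfl, hρ⟩ ⟨hr.1.le, hr.2⟩ hr.1
  · intro hL
    obtain ⟨q, hq, hLq⟩ := W.exists_lt_period L
    rw [← W.period_zero] at hL
    obtain ⟨r, hr, h⟩ := intermediate_value_Ioo hq.1.le (W.period_continuousOn hq.1.le hq.2)
      ⟨hL, hLq⟩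
    exact ⟨r, ⟨hr.1, hr.2.trans hq.2⟩, h⟩

end PotentialWell

/-! ### Periodic solutions: equilibria or well orbits -/

/-- Positive `2π`-periodic solutions of `φ'' = -f(φ)`. -/
structure IsPeriodicSolution (f φ : ℝ → ℝ) : Prop where
  contDiff : ContDiff ℝ 2 φ
  periodic : Function.Periodic φ (2 * π)
  pos : ∀ t, 0 < φ t
  ode : ∀ t, deriv (deriv φ) t = -f (φ t)

namespace IsPeriodicSolution

variable {f φ : ℝ → ℝ}

theorem hasDerivAt (h : IsPeriodicSolution f φ) (t : ℝ) : HasDerivAt φ (deriv φ t) t :=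
  (h.contDiff.differentiable two_ne_zero t).hasDerivAt

theorem deriv_hasDerivAt (h : IsPeriodicSolution f φ) (t : ℝ) :
    HasDerivAt (deriv φ) (-f (φ t)) t := by
  rw [← h.ode t]
  have h2 : ContDiff ℝ (1 + 1) φ := by simpa [one_add_one_eq_two] using h.contDiff
  exact ((contDiff_succ_iff_deriv.1 h2).2.2.differentiable one_ne_zero t).hasDerivAt

theorem continuous (h : IsPeriodicSolution f φ) : Continuous φ := h.contDiff.continuous

theorem of_hasDerivAt {φ' : ℝ → ℝ} (hd : ∀ t, HasDerivAt φ (φ' t) t)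
    (hd' : ∀ t, HasDerivAt φ' (-f (φ t)) t) (hf : ContinuousOn f (Set.Ioi 0))
    (hper : Function.Periodic φ (2 * π)) (hpos : ∀ t, 0 < φ t) : IsPeriodicSolution f φ where
  contDiff := by
    have e1 : deriv φ = φ' := funext fun t => (hd t).deriv
    have e2 : deriv φ' = fun t => -f (φ t) := funext fun t => (hd' t).deriv
    have hc : Continuous φ := continuous_iff_continuousAt.2 fun t => (hd t).continuousAt
    have h1 : ContDiff ℝ 1 φ' := by
      rw [contDiff_one_iff_deriv, e2]
      exact ⟨fun t => (hd' t).differentiableAt, (hf.comp_continuous hc hpos).neg⟩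
    have h2 : ContDiff ℝ (1 + 1) φ := by
      rw [contDiff_succ_iff_deriv, e1]
      exact ⟨fun t => (hd t).differentiableAt, by simp, h1⟩
    simpa [one_add_one_eq_two] using h2
  periodic := hper
  pos := hpos
  ode t := by
    have e1 : deriv φ = φ' := funext fun t => (hd t).deriv
    rw [e1, (hd' t).deriv]

theorem eq_of_force_nonneg (h : IsPeriodicSolution f φ) (hf : ∀ t, 0 ≤ f (φ t)) (s t : ℝ) :
    φ s = φ t := by
  apply eq_of_periodic_of_antitone_deriv two_pi_pos h.hasDerivAt h.periodic
  apply antitone_of_deriv_nonpos (fun t => (h.deriv_hasDerivAt t).differentiableAt)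
  intro t
  rw [h.ode]
  exact neg_nonpos.2 (hf t)

theorem force_eq_zero_of_eventually_eq (h : IsPeriodicSolution f φ) {t : ℝ}
    (ht : φ =ᶠ[nhds t] fun _ => φ t) : f (φ t) = 0 := by
  have h1 := ht.deriv.deriv.eq_of_nhds
  rw [h.ode] at h1
  simpa using h1

/-- A negative force would make φ'' > 0, so the maximum would also be a minimum; then φ is locally
constant and the force vanishes after all. -/
theorem force_nonneg_of_isLocalMax (h : IsPeriodicSolution f φ) {t : ℝ} (ht : IsLocalMax φ t) :
    0 ≤ f (φ t) := by
  by_contra! hneg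
  have hmin : IsLocalMin φ t := isLocalMin_of_deriv_deriv_pos (by rw [h.ode]; linarith)
    ht.deriv_eq_zero h.continuous.continuousAt
  have heq : φ =ᶠ[nhds t] fun _ => φ t := by
    filter_upwards [ht, hmin] with s h1 h2 using le_antisymm h1 h2
  exact hneg.ne (h.force_eq_zero_of_eventually_eq heq)

theorem force_nonpos_of_isLocalMin (h : IsPeriodicSolution f φ) {t : ℝ} (ht : IsLocalMin φ t) :
    f (φ t) ≤ 0 := by
  by_contra! hpos
  have hmax : IsLocalMax φ t := isLocalMax_of_deriv_deriv_neg (by rw [h.ode]; linarith)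
    ht.deriv_eq_zero h.continuous.continuousAt
  have heq : φ =ᶠ[nhds t] fun _ => φ t := by
    filter_upwards [ht, hmax] with s h1 h2 using le_antisymm h2 h1
  exact hpos.ne' (h.force_eq_zero_of_eventually_eq heq)

theorem exists_extrema (h : IsPeriodicSolution f φ) :
    ∃ t₀ t₁, ∀ t, φ t ∈ Set.Icc (φ t₁) (φ t₀) := by
  have hK := h.periodic.compact_of_continuous two_pi_pos.ne' h.continuous
  obtain ⟨_, ⟨t₀, rfl⟩, h0⟩ := hK.exists_isGreatest (Set.range_nonempty φ)
  obtain ⟨_, ⟨t₁, rfl⟩, h1⟩ := hK.exists_isLeast (Set.range_nonempty φ)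
  exact ⟨t₀, t₁, fun t => ⟨h1 ⟨t, rfl⟩, h0 ⟨t, rfl⟩⟩⟩

/-- ODE uniqueness against the equilibrium. The force is only known to be C¹ on (0, ∞), but φ ranges
in a compact interval there, on which it is Lipschitz. -/
theorem eq_of_force_eq_zero (h : IsPeriodicSolution f φ) (hf : ContDiffOn ℝ 1 f (Set.Ioi 0))
    {t₀ : ℝ} (h0 : f (φ t₀) = 0) (h1 : deriv φ t₀ = 0) (t : ℝ) : φ t = φ t₀ := by
  obtain ⟨p, q, hpq⟩ := h.exists_extrema
  obtain ⟨K, hK⟩ := exists_lipschitzOnWith_Icc hf (h.pos q) (b := φ p)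
  have := second_order_ode_unique hK h.hasDerivAt h.deriv_hasDerivAt hpq
    (χ := fun _ => φ t₀) (χ' := fun _ => 0) (t₀ := t₀) (fun t => hasDerivAt_const t _)
    (fun t => by rw [h0, neg_zero]; exact hasDerivAt_const t _) (fun _ => hpq t₀) rfl h1
  exact congrFun this t

end IsPeriodicSolution

namespace PotentialWell

variable {m c : ℝ} {f X N N' : ℝ → ℝ}

theorem force_nonneg_iff (W : PotentialWell m c f X N N') {u : ℝ} (hu : m < u) :
    0 ≤ f u ↔ c ≤ u := by
  have := sqrt_pos.2 (W.N_pos u hu)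
  rw [W.force_eq u hu, le_div_iff₀ this, zero_mul, ← W.X_center]
  exact W.strictMonoOn.le_iff_le W.lt.le hu.le

theorem force_c (W : PotentialWell m c f X N N') : f c = 0 := by
  rw [W.force_eq c W.lt, W.X_center, zero_div]

/-- Since X X' = f, the function X²/2 is a potential and this is conservation of energy. -/
theorem energy_const (W : PotentialWell m c f X N N') {φ : ℝ → ℝ}
    (h : IsPeriodicSolution f φ) (hm : ∀ t, m < φ t) (s t : ℝ) :
    deriv φ s ^ 2 + X (φ s) ^ 2 = deriv φ t ^ 2 + X (φ t) ^ 2 := by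
  have hd : ∀ t, HasDerivAt (fun t => deriv φ t ^ 2 + X (φ t) ^ 2) 0 t := by
    intro t
    have h1 := ((h.deriv_hasDerivAt t).pow 2).add
      (((W.X_hasDerivAt _ (hm t)).comp t (h.hasDerivAt t)).pow 2)
    refine h1.congr_deriv ?_
    rw [W.force_eq _ (hm t)]
    simp
    ring
  exact is_const_of_deriv_eq_zero (fun t => (hd t).differentiableAt) (fun t => (hd t).deriv) s t

theorem exists_eq_orbit (W : PotentialWell m c f X N N') {φ : ℝ → ℝ}
    (h : IsPeriodicSolution f φ) (hne : ∃ s t, φ s ≠ φ t) :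
    ∃ r ∈ Set.Ioo 0 (-X m), ∃ s, ∀ t, φ t = wellOrbit m X N r (t + s) := by
  obtain ⟨t₀, t₁, hext⟩ := h.exists_extrema
  have hnc : ∀ t', f (φ t') = 0 → deriv φ t' = 0 → False := fun t' h0 h1 => by
    obtain ⟨s, t, hst⟩ := hne
    exact hst ((h.eq_of_force_eq_zero W.force_contDiffOn h0 h1 s).trans
      (h.eq_of_force_eq_zero W.force_contDiffOn h0 h1 t).symm)
  have hmax : IsLocalMax φ t₀ := Filter.Eventually.of_forall fun t => (hext t).2
  have hmin : IsLocalMin φ t₁ := Filter.Eventually.of_forall fun t => (hext t).1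
  -- At the minimum f ≤ 0, whereas f > 0 below m; a minimum equal to m would force the equilibrium
  -- solution.
  have hma : m < φ t₁ := by
    rcases lt_trichotomy m (φ t₁) with hlt | heq | hgt
    · exact hlt
    · exact (hnc t₁ (by rw [← heq]; exact W.force_m) hmin.deriv_eq_zero).elim
    · exact absurd (h.force_nonpos_of_isLocalMin hmin) (not_le.2 (W.force_pos _ (h.pos _) hgt))
  have hm : ∀ t, m < φ t := fun t => hma.trans_le (hext t).1
  have hcb : c < φ t₀ := by
    refine lt_of_le_of_ne
      ((W.force_nonneg_iff (hm t₀)).1 (h.force_nonneg_of_isLocalMax hmax)) fun heq => ?_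
    exact hnc t₀ (by rw [← heq]; exact W.force_c) hmax.deriv_eq_zero
  set r := X (φ t₀) with hr
  have hr0 : 0 < r := by
    rw [hr, ← W.X_center]
    exact W.strictMonoOn W.lt.le (hm t₀).le hcb
  have hab : φ t₁ < φ t₀ := by
    refine lt_of_le_of_ne (hext t₁).2 fun heq => ?_
    obtain ⟨s, t, hst⟩ := hne
    exact hst (((hext s).2.antisymm (heq ▸ (hext s).1)).trans
      ((hext t).2.antisymm (heq ▸ (hext t).1)).symm)
  -- Both extrema have zero velocity, so energy conservation gives X² = r² there. This puts r below
  -- -X m and confines the comparison orbit to the range of φ.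
  have hXa : X (φ t₁) = -r := by
    have he := W.energy_const h hm t₀ t₁
    rw [hmax.deriv_eq_zero, hmin.deriv_eq_zero] at he
    have h1 := W.strictMonoOn (hm t₁).le (hm t₀).le hab
    have h2 : (X (φ t₁) - r) * (X (φ t₁) + r) = 0 := by rw [hr]; linear_combination -he
    rcases mul_eq_zero.1 h2 with h3 | h3
    · exact absurd h3 (by linarith : X (φ t₁) - r < 0).ne
    · linarith
  have hrρ : r < -X m := by
    have := W.strictMonoOn Set.self_mem_Ici (hm t₁).le (hm t₁)
    linarith
  obtain ⟨K, hK⟩ := exists_lipschitzOnWith_Icc W.force_contDiffOn (h.pos t₁) (b := φ t₀)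
  have hmem : ∀ t, wellOrbit m X N r t ∈ Set.Icc (φ t₁) (φ t₀) := by
    intro t
    have hlt := W.lt_orbit hr0.le hrρ t
    have hX := W.X_orbit hr0.le hrρ t
    have hcs := abs_le.1 (abs_cos_le_one (wellAngle m X N r t))
    constructor
    · rw [← W.strictMonoOn.le_iff_le (hm t₁).le hlt.le, hX, hXa]
      nlinarith [hcs.1]
    · rw [← W.strictMonoOn.le_iff_le hlt.le (hm t₀).le, hX]
      nlinarith [hcs.2]
  have heq := second_order_ode_unique hK (t₀ := t₀) h.hasDerivAt h.deriv_hasDerivAt hext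
    (χ := fun t => wellOrbit m X N r (t + -t₀))
    (fun t => (W.orbit_hasDerivAt hr0.le hrρ (t + -t₀)).comp_add_const t (-t₀))
    (fun t => (W.orbit_deriv_hasDerivAt hr0.le hrρ (t + -t₀)).comp_add_const t (-t₀))
    (fun t => hmem _)
    (by simp only [add_neg_cancel]; rw [W.orbit_zero hr0.le hrρ, hr, W.inv_X (hm t₀)])
    (by simp only [add_neg_cancel]
        rw [W.angle_zero hr0.le hrρ, hmax.deriv_eq_zero, sin_zero, mul_zero, neg_zero])
  exact ⟨r, ⟨hr0, hrρ⟩, -t₀, fun t => congrFun heq t⟩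

/-- Position and velocity determine the angle modulo 2π, and the angle increases; over one period of
φ it therefore gains 2πn with n ≥ 1, which takes n well periods. -/
theorem exists_nat_mul_period (W : PotentialWell m c f X N N') {r s : ℝ} (h0 : 0 < r)
    (hr : r < -X m) (hper : Function.Periodic (fun t => wellOrbit m X N r (t + s)) (2 * π)) :
    ∃ n : ℕ, 1 ≤ n ∧ n * wellPeriod m X N r = 2 * π := by
  have hd : ∀ t, HasDerivAt (fun t => wellOrbit m X N r (t + s))
      (-(r * sin (wellAngle m X N r (t + s)))) t := fun t =>
    (W.orbit_hasDerivAt h0.le hr (t + s)).comp_add_const t s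
  have hc : cos (wellAngle m X N r (2 * π + s)) = cos (wellAngle m X N r s) := by
    have h1 := congrArg X (hper 0)
    simp only [zero_add] at h1
    rw [W.X_orbit h0.le hr, W.X_orbit h0.le hr] at h1
    exact mul_left_cancel₀ h0.ne' h1
  have hs : sin (wellAngle m X N r (2 * π + s)) = sin (wellAngle m X N r s) := by
    have h1 : HasDerivAt (fun t => wellOrbit m X N r (t + 2 * π + s)) _ 0 :=
      (hd (0 + 2 * π)).comp_add_const 0 (2 * π)
    have h2 : (fun t => wellOrbit m X N r (t + 2 * π + s)) =
        fun t => wellOrbit m X N r (t + s) := funext hper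
    rw [h2] at h1
    have h3 := h1.unique (hd 0)
    simp only [zero_add, neg_inj] at h3
    exact mul_left_cancel₀ h0.ne' h3
  have h1 : cos (wellAngle m X N r (2 * π + s) - wellAngle m X N r s) = 1 := by
    rw [cos_sub, hc, hs, ← sq, ← sq, cos_sq_add_sin_sq]
  obtain ⟨k, hk⟩ := (cos_eq_one_iff _).1 h1
  have hlt := W.angle_strictMono h0.le hr (by linarith [pi_pos] : s < 2 * π + s)
  have hk0 : 0 < k := by
    have : 0 < (k : ℝ) * (2 * π) := by rw [hk]; linarith
    exact_mod_cast pos_of_mul_pos_left this two_pi_pos.le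
  lift k to ℕ using hk0.le
  refine ⟨k, by omega, ?_⟩
  have h2 := W.angle_add_nat_mul_period h0.le hr k s
  have h3 : wellAngle m X N r (s + k * wellPeriod m X N r) = wellAngle m X N r (2 * π + s) := by
    rw [h2]; push_cast at hk; linarith
  have := (W.angle_strictMono h0.le hr).injective h3
  linarith

theorem orbit_isPeriodicSolution (W : PotentialWell m c f X N N') {r : ℝ} {n : ℕ} (h0 : 0 < r)
    (hr : r < -X m) (hn : n * wellPeriod m X N r = 2 * π) :
    IsPeriodicSolution f (wellOrbit m X N r) :=
  .of_hasDerivAt (W.orbit_hasDerivAt h0.le hr) (W.orbit_deriv_hasDerivAt h0.le hr)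
    W.force_contDiffOn.continuousOn
    (fun t => by
      simp only [wellOrbit]
      rw [← hn, W.angle_add_nat_mul_period h0.le hr, cos_add_nat_mul_two_pi])
    fun t => W.pos.trans (W.lt_orbit h0.le hr t)

/-- φ - c has the sign of X(φ) = r cos θ and the velocity is -r sin θ, so the curve stays in the
open half plane of direction θ, which makes n clockwise turns. The factor ω only rescales the
vertical axis. -/
theorem orbit_windsClockwise (W : PotentialWell m c f X N N') {r : ℝ} {n : ℕ} (h0 : 0 < r)
    (hr : r < -X m) (hn : n * wellPeriod m X N r = 2 * π) {φ : ℝ → ℝ} {s : ℝ}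
    (hφ : ∀ t, φ t = wellOrbit m X N r (t + s)) {ω : ℝ} (hω : 0 < ω) :
    WindsClockwise φ (fun t => ω * deriv φ t) c 0 n := by
  have hd : ∀ t, HasDerivAt φ (-(r * sin (wellAngle m X N r (t + s)))) t := fun t => by
    rw [show φ = fun t => wellOrbit m X N r (t + s) from funext hφ]
    exact (W.orbit_hasDerivAt h0.le hr (t + s)).comp_add_const t s
  have hθ : Continuous fun t => wellAngle m X N r (t + s) :=
    (W.angle_continuous h0.le hr).comp (continuous_add_const s)
  have hder : deriv φ = fun t => -(r * sin (wellAngle m X N r (t + s))) :=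
    funext fun t => (hd t).deriv
  have hturn : wellAngle m X N r (2 * π + s) = wellAngle m X N r (0 + s) + n * (2 * π) := by
    rw [← W.angle_add_nat_mul_period h0.le hr, hn]
    congr 1; ring
  apply WindsClockwise.of_inner_pos
    (continuous_iff_continuousAt.2 fun t => (hd t).continuousAt) _ hθ
  · rw [hφ, hφ, wellOrbit, hturn, cos_add_nat_mul_two_pi, wellOrbit]
  · rw [hder]
    simp only
    rw [hturn, sin_add_nat_mul_two_pi]
  · rw [hturn]; push_cast; ring
  · intro t
    rw [hder]
    simp only
    set θ := wellAngle m X N r (t + s) with hθdef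
    have hlt : m < φ t := by rw [hφ]; exact W.lt_orbit h0.le hr _
    have hX : X (φ t) = r * cos θ := by rw [hφ]; exact W.X_orbit h0.le hr _
    have hsplit : (φ t - c) * cos θ - (ω * -(r * sin θ) - 0) * sin θ =
        (φ t - c) * cos θ + ω * r * sin θ ^ 2 := by ring
    rw [hsplit]
    rcases lt_trichotomy (cos θ) 0 with hc | hc | hc
    · have : φ t < c := by
        rw [← W.strictMonoOn.lt_iff_lt hlt.le W.lt.le, hX, W.X_center]
        exact mul_neg_of_pos_of_neg h0 hc
      have h1 := mul_pos_of_neg_of_neg (sub_neg.2 this) hc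
      positivity
    · have := sin_sq_add_cos_sq θ
      rw [hc] at this
      have h1 : sin θ ^ 2 = 1 := by linarith
      rw [hc, h1]
      simp only [mul_zero, zero_add, mul_one]
      positivity
    · have : c < φ t := by
        rw [← W.strictMonoOn.lt_iff_lt W.lt.le hlt.le, hX, W.X_center]
        exact mul_pos h0 hc
      have h1 := mul_pos (sub_pos.2 this) hc
      positivity
  · rw [hder]
    exact (((continuous_sin.comp hθ).const_mul r).neg).const_mul ω

end PotentialWell

/-! ### Chicone's criterion for the normalised well -/

/-!
The normalised well: with `w = u²` the potential relative to the stable equilibrium `u = 1` is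
`(w - 1)² Q(w) / (6 w³)`, with derivative `(w² - 1) D(w) u⁻⁷` in `u`.
-/

/-- The cofactor of `(w - 1)²` in the potential. -/
noncomputable def lichQ (l w : ℝ) : ℝ := w ^ 4 + 2 * w ^ 3 - 3 * l * w ^ 2 - 2 * l * w - l

/-- The cofactor of `w² - 1` in the force. -/
noncomputable def lichD (l w : ℝ) : ℝ := w ^ 4 - l * w ^ 2 - l

/-- The numerator of the first derivative of `w⁴ Q / (3 (w + 1)² D²)`. -/
noncomputable def lichP (l w : ℝ) : ℝ :=
  4 * l ^ 2 + 12 * l ^ 2 * w + 24 * l ^ 2 * w ^ 2 + (12 * l ^ 2 - 14 * l) * w ^ 3 +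
    (4 * l ^ 2 - 14 * l) * w ^ 4 + 10 * l * w ^ 6 + (10 * l - 2) * w ^ 7 - 6 * w ^ 8 - 2 * w ^ 9

/-- The numerator of the second derivative, with respect to `√w`, of `w⁴ Q / (3 (w + 1)² D²)`. -/
noncomputable def lichE (l w : ℝ) : ℝ :=
  -28 * l ^ 3 - 112 * l ^ 3 * w - 280 * l ^ 3 * w ^ 2 + (182 * l ^ 2 - 196 * l ^ 3) * w ^ 3 +
    (240 * l ^ 2 - 12 * l ^ 3) * w ^ 4 + (120 * l ^ 3 - 132 * l ^ 2) * w ^ 5 +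
    (48 * l ^ 3 - 782 * l ^ 2) * w ^ 6 + (196 * l - 970 * l ^ 2 + 12 * l ^ 3) * w ^ 7 +
    (532 * l - 460 * l ^ 2) * w ^ 8 + (380 * l - 160 * l ^ 2) * w ^ 9 +
    (60 * l - 30 * l ^ 2) * w ^ 10 + (6 - 84 * l) * w ^ 11 + (24 - 76 * l) * w ^ 12 +
    40 * w ^ 13 + 10 * w ^ 14

/-- Write w = 1 + z and homogenise the cubic in l with a = 2l, b = 1 - 2l, a + b = 1: all
coefficients become nonnegative. The a³ part vanishes at z = 0, so positivity at w = 1 needs l <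
1/2. -/
theorem lichE_pos_of_one_le {l w : ℝ} (hl : 0 < l) (hl' : l < 1 / 2) (hw : 1 ≤ w) :
    0 < lichE l w := by
  obtain ⟨z, hz, rfl⟩ : ∃ z, 0 ≤ z ∧ w = 1 + z := ⟨w - 1, by linarith, by ring⟩
  obtain ⟨a, ha⟩ : ∃ a, a = 2 * l := ⟨_, rfl⟩
  obtain ⟨b, hb⟩ : ∃ b, b = 1 - 2 * l := ⟨_, rfl⟩
  have ha0 : 0 < a := by linarith
  have hb0 : 0 < b := by linarith
  have key : lichE l (1 + z) =
      b ^ 3 * (80 + 1014 * z + 5944 * z ^ 2 + 21350 * z ^ 3 + 52470 * z ^ 4 + 93280 * z ^ 5 +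
        123618 * z ^ 6 + 123948 * z ^ 7 + 94380 * z ^ 8 + 54230 * z ^ 9 + 23100 * z ^ 10 +
        7054 * z ^ 11 + 1454 * z ^ 12 + 180 * z ^ 13 + 10 * z ^ 14) +
      a * b ^ 2 * (744 + 6948 * z + 30710 * z ^ 2 + 86646 * z ^ 3 + 177030 * z ^ 4 +
        278794 * z ^ 5 + 346732 * z ^ 6 + 340554 * z ^ 7 + 260726 * z ^ 8 + 152510 * z ^ 9 +
        66360 * z ^ 10 + 20664 * z ^ 11 + 4324 * z ^ 12 + 540 * z ^ 13 + 30 * z ^ 14) +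
      a ^ 2 * b * (720 + 6840 * z + 30732 * z ^ 2 + 86100 * z ^ 3 + 170460 * z ^ 4 +
        516159 / 2 * z ^ 5 + 312562 * z ^ 6 + 611523 / 2 * z ^ 7 + 474999 / 2 * z ^ 8 +
        142215 * z ^ 9 + 126825 / 2 * z ^ 10 + 20166 * z ^ 11 + 4286 * z ^ 12 + 540 * z ^ 13 +
        30 * z ^ 14) +
      a ^ 3 * (864 * z + 6120 * z ^ 2 + 21096 * z ^ 3 + 46116 * z ^ 4 + 72648 * z ^ 5 +
        178929 / 2 * z ^ 6 + 89157 * z ^ 7 + 142307 / 2 * z ^ 8 + 43935 * z ^ 9 +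
        40305 / 2 * z ^ 10 + 6556 * z ^ 11 + 1416 * z ^ 12 + 180 * z ^ 13 + 10 * z ^ 14) := by
    rw [ha, hb, lichE]
    ring
  rw [key]
  positivity

/-- Here the natural variables are a = l(1 + w²) and b = `lichD l w`, with a + b = w⁴, and w + y =
1. The factor (1 + w²)³ clears the denominators of l, and the extra w makes the coefficients
divisible by the powers of w⁴ needed to homogenise. -/
theorem lichE_pos_of_le_one {l w : ℝ} (hl : 0 < l) (hw : 0 < w) (hw1 : w ≤ 1)
    (hD : 0 < lichD l w) : 0 < lichE l w := by
  obtain ⟨y, hy⟩ : ∃ y, y = 1 - w := ⟨_, rfl⟩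
  obtain ⟨a, ha⟩ : ∃ a, a = l * (1 + w ^ 2) := ⟨_, rfl⟩
  obtain ⟨b, hb⟩ : ∃ b, b = w ^ 4 - l * (1 + w ^ 2) := ⟨_, rfl⟩
  have hy0 : 0 ≤ y := by linarith
  have ha0 : 0 < a := by rw [ha]; positivity
  have hb0 : 0 < b := by
    rw [lichD] at hD
    linarith
  have key : lichE l w * ((1 + w ^ 2) ^ 3 * w) =
      b ^ 3 * (640 * w ^ 9 + 2768 * w ^ 8 * y + 5760 * w ^ 7 * y ^ 2 + 7432 * w ^ 6 * y ^ 3 +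
        6488 * w ^ 5 * y ^ 4 + 3948 * w ^ 4 * y ^ 5 + 1664 * w ^ 3 * y ^ 6 +
        466 * w ^ 2 * y ^ 7 + 78 * w * y ^ 8 + 6 * y ^ 9) +
      a * b ^ 2 * (5952 * w ^ 9 + 33504 * w ^ 8 * y + 85024 * w ^ 7 * y ^ 2 +
        129288 * w ^ 6 * y ^ 3 + 130216 * w ^ 5 * y ^ 4 + 90160 * w ^ 4 * y ^ 5 +
        42880 * w ^ 3 * y ^ 6 + 13482 * w ^ 2 * y ^ 7 + 2530 * w * y ^ 8 + 214 * y ^ 9) +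
      a ^ 2 * b * (5760 * w ^ 9 + 44352 * w ^ 8 * y + 136608 * w ^ 7 * y ^ 2 +
        238800 * w ^ 6 * y ^ 3 + 267568 * w ^ 5 * y ^ 4 + 201544 * w ^ 4 * y ^ 5 +
        102584 * w ^ 3 * y ^ 6 + 34088 * w ^ 2 * y ^ 7 + 6704 * w * y ^ 8 + 592 * y ^ 9) +
      a ^ 3 * (10368 * w ^ 8 * y + 48384 * w ^ 7 * y ^ 2 + 103968 * w ^ 6 * y ^ 3 +
        132768 * w ^ 5 * y ^ 4 + 109536 * w ^ 4 * y ^ 5 + 59520 * w ^ 3 * y ^ 6 +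
        20736 * w ^ 2 * y ^ 7 + 4224 * w * y ^ 8 + 384 * y ^ 9) := by
    rw [hb, ha, hy, lichE]
    ring
  have : 0 < lichE l w * ((1 + w ^ 2) ^ 3 * w) := by
    rw [key]
    positivity
  exact pos_of_mul_pos_left this (by positivity)

/-- `lichQ` decreases in l, so l = 1/2 is the worst case. The lower bound also carries the growth
used in `exists_le_lichX`. -/
theorem lt_lichQ_of_one_le {l w : ℝ} (hl' : l < 1 / 2) (hw : 1 ≤ w) :
    (w - 1) * w ^ 3 < lichQ l w := by
  have h1 : l * (3 * w ^ 2 + 2 * w + 1) < 1 / 2 * (3 * w ^ 2 + 2 * w + 1) := by gcongr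
  obtain ⟨z, hz, rfl⟩ : ∃ z, 0 ≤ z ∧ w = 1 + z := ⟨w - 1, by linarith, by ring⟩
  have h2 : 0 ≤ 5 * z + 15 / 2 * z ^ 2 + 3 * z ^ 3 := by positivity
  rw [lichQ]
  linarith

theorem lichQ_pos_of_lt_one {l w : ℝ} (hw : 0 < w) (hw1 : w < 1)
    (hD : 0 ≤ lichD l w) : 0 < lichQ l w := by
  have key : lichQ l w * (1 + w ^ 2) =
      lichD l w * (3 * w ^ 2 + 2 * w + 1) + 2 * w ^ 3 * ((1 - w) * (1 + w + w ^ 2)) := by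
    rw [lichQ, lichD]; ring
  have h1 : 0 < 1 - w := by linarith
  have : 0 < lichQ l w * (1 + w ^ 2) := by
    rw [key]
    positivity
  exact pos_of_mul_pos_left this (by positivity)

theorem lichQ_hasDerivAt (l w : ℝ) :
    HasDerivAt (lichQ l) (4 * w ^ 3 + 6 * w ^ 2 - 6 * l * w - 2 * l) w := by
  have := (((((hasDerivAt_pow 4 w).add ((hasDerivAt_pow 3 w).const_mul 2)).sub
    ((hasDerivAt_pow 2 w).const_mul (3 * l))).sub ((hasDerivAt_id w).const_mul (2 * l))).sub_const l)
  exact this.congr_deriv (by push_cast; ring)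

theorem lichD_hasDerivAt (l w : ℝ) : HasDerivAt (lichD l) (4 * w ^ 3 - 2 * l * w) w := by
  have := (((hasDerivAt_pow 4 w).sub ((hasDerivAt_pow 2 w).const_mul l)).sub_const l)
  exact this.congr_deriv (by push_cast; ring)

theorem lichP_hasDerivAt (l w : ℝ) : HasDerivAt (lichP l)
    (12 * l ^ 2 + 48 * l ^ 2 * w + 3 * (12 * l ^ 2 - 14 * l) * w ^ 2 +
      4 * (4 * l ^ 2 - 14 * l) * w ^ 3 + 60 * l * w ^ 5 + 7 * (10 * l - 2) * w ^ 6 -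
      48 * w ^ 7 - 18 * w ^ 8) w := by
  have := ((((((((hasDerivAt_const w (4 * l ^ 2)).add
    ((hasDerivAt_id w).const_mul (12 * l ^ 2))).add
    ((hasDerivAt_pow 2 w).const_mul (24 * l ^ 2))).add
    ((hasDerivAt_pow 3 w).const_mul (12 * l ^ 2 - 14 * l))).add
    ((hasDerivAt_pow 4 w).const_mul (4 * l ^ 2 - 14 * l))).add
    ((hasDerivAt_pow 6 w).const_mul (10 * l))).add
    ((hasDerivAt_pow 7 w).const_mul (10 * l - 2))).sub
    ((hasDerivAt_pow 8 w).const_mul 6)).sub ((hasDerivAt_pow 9 w).const_mul 2)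
  exact this.congr_deriv (by push_cast; ring)

theorem lichN_hasDerivAt_aux {l w : ℝ} (hw : 0 < w) (hD : 0 < lichD l w) :
    HasDerivAt (fun w => w ^ 4 * lichQ l w / (3 * (w + 1) ^ 2 * lichD l w ^ 2))
      (w ^ 3 * lichP l w / (3 * (w + 1) ^ 3 * lichD l w ^ 3)) w := by
  have h := ((hasDerivAt_pow 4 w).mul (lichQ_hasDerivAt l w)).div
    (((((hasDerivAt_id w).add_const 1).pow 2).const_mul 3).mul ((lichD_hasDerivAt l w).pow 2))
    (by simp only [id, Pi.mul_apply, Pi.pow_apply]; positivity)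
  refine h.congr_deriv ?_
  -- Returns the expanded numerator to its quotient-rule form, in which `lichQ` and `lichD` can be
  -- treated as atoms.
  have hP : lichP l w =
      (4 * lichQ l w + w * (4 * w ^ 3 + 6 * w ^ 2 - 6 * l * w - 2 * l)) * (w + 1) * lichD l w -
      2 * w * lichQ l w * lichD l w -
      2 * w * lichQ l w * (4 * w ^ 3 - 2 * l * w) * (w + 1) := by
    rw [lichP, lichQ, lichD]; ring
  rw [hP]
  simp only [id, Pi.mul_apply, Pi.pow_apply]
  push_cast
  field_simp
  ring

/-- `lichE` belongs to the variable u = √w: for the function G here, (2u G(u²))' = 2G + 4wG', and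
the term 2G cancels the subtracted `lichP` term. -/
theorem lichN'_hasDerivAt_aux {l w : ℝ} (hw : 0 < w) (hD : 0 < lichD l w) :
    HasDerivAt (fun w => w ^ 3 * lichP l w / (3 * (w + 1) ^ 3 * lichD l w ^ 3))
      (w ^ 2 * (lichE l w - lichP l w * (w + 1) * lichD l w) /
        (2 * (3 * (w + 1) ^ 4 * lichD l w ^ 4))) w := by
  have h := ((hasDerivAt_pow 3 w).mul (lichP_hasDerivAt l w)).div
    (((((hasDerivAt_id w).add_const 1).pow 3).const_mul 3).mul ((lichD_hasDerivAt l w).pow 3))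
    (by simp only [id, Pi.mul_apply, Pi.pow_apply]; positivity)
  refine h.congr_deriv ?_
  have hE : lichE l w = 2 * ((3 * lichP l w +
      w * (12 * l ^ 2 + 48 * l ^ 2 * w + 3 * (12 * l ^ 2 - 14 * l) * w ^ 2 +
      4 * (4 * l ^ 2 - 14 * l) * w ^ 3 + 60 * l * w ^ 5 + 7 * (10 * l - 2) * w ^ 6 -
      48 * w ^ 7 - 18 * w ^ 8)) * (w + 1) * lichD l w -
      3 * w * lichP l w * lichD l w -
      3 * w * lichP l w * (4 * w ^ 3 - 2 * l * w) * (w + 1)) +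
      lichP l w * (w + 1) * lichD l w := by
    rw [lichE, lichP, lichD]; ring
  rw [hE]
  simp only [id, Pi.mul_apply, Pi.pow_apply]
  push_cast
  field_simp
  ring

/-- The signed square root of twice the normalised potential. -/
noncomputable def lichX (l u : ℝ) : ℝ := (u ^ 2 - 1) * √(lichQ l (u ^ 2) / (3 * (u ^ 2) ^ 3))

/-- The inverse square of the derivative of `lichX`. -/
noncomputable def lichN (l u : ℝ) : ℝ :=
  (u ^ 2) ^ 4 * lichQ l (u ^ 2) / (3 * (u ^ 2 + 1) ^ 2 * lichD l (u ^ 2) ^ 2)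

/-- The derivative of `lichN`. -/
noncomputable def lichN' (l u : ℝ) : ℝ :=
  2 * u * ((u ^ 2) ^ 3 * lichP l (u ^ 2) / (3 * (u ^ 2 + 1) ^ 3 * lichD l (u ^ 2) ^ 3))

/-- The normalised force. -/
noncomputable def lichF (l u : ℝ) : ℝ := u ^ 5 + l * (u ^ 7)⁻¹ - (1 + l) * u

theorem lichF_eq {l u : ℝ} (hu : u ≠ 0) :
    lichF l u = (u ^ 2 - 1) * ((u ^ 2 + 1) * lichD l (u ^ 2) / u ^ 7) := by
  rw [lichF, lichD]
  field_simp
  ring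

theorem lichN_hasDerivAt {l u : ℝ} (hu : 0 < u) (hD : 0 < lichD l (u ^ 2)) :
    HasDerivAt (lichN l) (lichN' l u) u := by
  have := (lichN_hasDerivAt_aux (by positivity) hD).comp
    (h := fun x : ℝ => x ^ 2) u (hasDerivAt_pow 2 u)
  exact this.congr_deriv (by rw [lichN']; push_cast; ring)

theorem lichN'_hasDerivAt {l u : ℝ} (hu : 0 < u) (hD : 0 < lichD l (u ^ 2)) :
    HasDerivAt (lichN' l) (2 * (u ^ 2) ^ 3 * lichE l (u ^ 2) /
      (3 * (u ^ 2 + 1) ^ 4 * lichD l (u ^ 2) ^ 4)) u := by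
  have h := ((hasDerivAt_id u).const_mul 2).mul
    ((lichN'_hasDerivAt_aux (by positivity) hD).comp (h := fun x : ℝ => x ^ 2) u
      (hasDerivAt_pow 2 u))
  refine h.congr_deriv ?_
  simp only [id, Function.comp_apply]
  push_cast
  field_simp
  ring

theorem sqrt_lichN {l u : ℝ} (hu : 0 < u) (hD : 0 < lichD l (u ^ 2)) :
    √(lichN l u) = √(lichQ l (u ^ 2) / (3 * (u ^ 2) ^ 3)) *
      (u ^ 7 / ((u ^ 2 + 1) * lichD l (u ^ 2))) := by
  have h : 0 ≤ u ^ 7 / ((u ^ 2 + 1) * lichD l (u ^ 2)) := by positivity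
  rw [← sqrt_sq h, ← sqrt_mul' _ (sq_nonneg _), lichN]
  congr 1
  field_simp

theorem lichX_hasDerivAt {l u : ℝ} (hu : 0 < u) (hD : 0 < lichD l (u ^ 2))
    (hQ : 0 < lichQ l (u ^ 2)) : HasDerivAt (lichX l) (1 / √(lichN l u)) u := by
  have hu2 : 0 < u ^ 2 := by positivity
  have h1 := (lichQ_hasDerivAt l (u ^ 2)).div ((hasDerivAt_pow 3 (u ^ 2)).const_mul 3)
    (by positivity)
  have h2 := (h1.comp (h := fun x : ℝ => x ^ 2) u (hasDerivAt_pow 2 u)).sqrt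
    (by simp only [Function.comp_apply, Pi.div_apply]; positivity)
  have h3 := ((hasDerivAt_pow 2 u).sub_const 1).mul h2
  refine h3.congr_deriv ?_
  rw [sqrt_lichN hu hD]
  have hR : 0 < lichQ l (u ^ 2) / (3 * (u ^ 2) ^ 3) := by positivity
  have hs := sqrt_pos.2 hR
  have hs2 := sq_sqrt hR.le
  simp only [Function.comp_apply, Pi.div_apply]
  set S := √(lichQ l (u ^ 2) / (3 * (u ^ 2) ^ 3)) with hS
  have hQS : lichQ l (u ^ 2) = S ^ 2 * (3 * (u ^ 2) ^ 3) := by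
    rw [hs2]; field_simp
  -- The potential differentiates to the force, with the common factor w - 1 removed.
  have hDQ : 3 * (u ^ 2 + 1) * lichD l (u ^ 2) = 2 * lichQ l (u ^ 2) * u ^ 2 + (u ^ 2 - 1) *
      ((4 * (u ^ 2) ^ 3 + 6 * (u ^ 2) ^ 2 - 6 * l * u ^ 2 - 2 * l) * u ^ 2 -
        3 * lichQ l (u ^ 2)) := by
    rw [lichD, lichQ]; ring
  push_cast
  have hS2 : S ^ 2 = lichQ l (u ^ 2) / (3 * (u ^ 2) ^ 3) := hs2
  field_simp
  rw [hS2]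
  field_simp
  linear_combination (-1 : ℝ) * hDQ

theorem exists_lichD_eq_zero {l : ℝ} (hl : 0 < l) (hl' : l < 1 / 2) :
    ∃ m ∈ Set.Ioo (0 : ℝ) 1, lichD l (m ^ 2) = 0 := by
  have hc : ContinuousOn (fun u : ℝ => lichD l (u ^ 2)) (Set.Icc 0 1) := by
    unfold lichD
    fun_prop
  exact intermediate_value_Ioo zero_le_one hc
    ⟨by simp [lichD, hl], by simp only [lichD]; linarith⟩

theorem lichD_sub {l m u : ℝ} (hD : lichD l (m ^ 2) = 0) :
    lichD l (u ^ 2) = (u ^ 4 - m ^ 4) * (u ^ 4 + (m ^ 4 - l)) := by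
  rw [← sub_zero (lichD l (u ^ 2)), ← hD, lichD, lichD]
  ring

/-- In u⁴, `lichD` is a quadratic with roots m⁴ and l - m⁴ and product -l; the second root is thus
negative, and `lichD` changes sign only at m. -/
theorem lt_pow_four_of_lichD_eq_zero {l m : ℝ} (hl : 0 < l) (hm : 0 < m)
    (hD : lichD l (m ^ 2) = 0) : l < m ^ 4 := by
  have h : m ^ 4 * (m ^ 4 - l) = l := by
    rw [lichD] at hD
    linear_combination hD
  have : 0 < m ^ 4 * (m ^ 4 - l) := by rw [h]; exact hl
  have := pos_of_mul_pos_right this (by positivity)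
  linarith

theorem lichD_pos {l m u : ℝ} (hl : 0 < l) (hm : 0 < m) (hD : lichD l (m ^ 2) = 0)
    (hu : m < u) : 0 < lichD l (u ^ 2) := by
  rw [lichD_sub hD]
  have h1 : m ^ 4 < u ^ 4 := by gcongr
  have h2 := lt_pow_four_of_lichD_eq_zero hl hm hD
  have h3 : 0 < u ^ 4 - m ^ 4 := by linarith
  have h4 : 0 < u ^ 4 + (m ^ 4 - l) := by nlinarith [pow_pos hm 4]
  positivity

theorem lichQ_pos {l m u : ℝ} (hl : 0 < l) (hl' : l < 1 / 2) (hm : 0 < m)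
    (hD : lichD l (m ^ 2) = 0) (hu : m ≤ u) : 0 < lichQ l (u ^ 2) := by
  have hu0 : 0 < u := hm.trans_le hu
  rcases lt_or_ge u 1 with h1 | h1
  · apply lichQ_pos_of_lt_one (by positivity) (by nlinarith)
    rcases hu.eq_or_lt with rfl | h
    · exact hD.ge
    · exact (lichD_pos hl hm hD h).le
  · have h2 : 1 ≤ u ^ 2 := one_le_pow₀ h1
    refine lt_of_le_of_lt ?_ (lt_lichQ_of_one_le hl' h2)
    have : 0 ≤ u ^ 2 - 1 := by linarith
    positivity

theorem lichN_pos {l m u : ℝ} (hl : 0 < l) (hl' : l < 1 / 2) (hm : 0 < m)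
    (hD : lichD l (m ^ 2) = 0) (hu : m < u) : 0 < lichN l u := by
  have h1 := lichQ_pos hl hl' hm hD hu.le
  have h2 := lichD_pos hl hm hD hu
  have h3 := hm.trans hu
  rw [lichN]
  positivity

theorem lichN'_strictMonoOn {l m : ℝ} (hl : 0 < l) (hl' : l < 1 / 2) (hm : 0 < m)
    (hD : lichD l (m ^ 2) = 0) : StrictMonoOn (lichN' l) (Set.Ioi m) := by
  have hd : ∀ u ∈ Set.Ioi m, HasDerivAt (lichN' l) _ u := fun u hu =>
    lichN'_hasDerivAt (hm.trans hu) (lichD_pos hl hm hD hu)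
  apply strictMonoOn_of_deriv_pos (convex_Ioi m)
    fun u hu => (hd u hu).continuousAt.continuousWithinAt
  intro u hu
  rw [interior_Ioi] at hu
  rw [(hd u hu).deriv]
  have hu0 : 0 < u := hm.trans hu
  have hDu := lichD_pos hl hm hD hu
  have hE : 0 < lichE l (u ^ 2) := by
    rcases le_total (u ^ 2) 1 with h1 | h1
    · exact lichE_pos_of_le_one hl (by positivity) h1 hDu
    · exact lichE_pos_of_one_le hl hl' h1
  positivity

theorem lichF_contDiffOn (l : ℝ) : ContDiffOn ℝ 1 (lichF l) (Set.Ioi 0) := by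
  unfold lichF
  have h : ContDiffOn ℝ 1 (fun u : ℝ => (u ^ 7)⁻¹) (Set.Ioi 0) :=
    (contDiff_id.pow 7).contDiffOn.inv fun u hu => (pow_pos hu 7).ne'
  exact (((contDiff_id.pow 5).contDiffOn.add (contDiffOn_const.mul h)).sub
    (contDiffOn_const.mul contDiffOn_id))

theorem lichX_continuousOn (l : ℝ) : ContinuousOn (lichX l) (Set.Ioi 0) := by
  intro u hu
  have h0 : 3 * (u ^ 2) ^ 3 ≠ 0 := by have := Set.mem_Ioi.1 hu; positivity
  have hQ : Continuous fun u : ℝ => lichQ l (u ^ 2) := by unfold lichQ; fun_prop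
  have h1 : ContinuousAt (fun u => lichQ l (u ^ 2) / (3 * (u ^ 2) ^ 3)) u :=
    hQ.continuousAt.div (by fun_prop) h0
  exact (ContinuousAt.mul (by fun_prop) h1.sqrt).continuousWithinAt

theorem exists_le_lichX {l : ℝ} (hl' : l < 1 / 2) (A : ℝ) : ∃ M, 1 < M ∧ A ≤ lichX l M := by
  have hA := abs_nonneg A
  have h0 : 0 ≤ 2 + 2 * |A| := by positivity
  -- With u² = 2 + 2|A| the factor u² - 1 exceeds 2|A| and the square root is at least 1/2.
  refine ⟨√(2 + 2 * |A|), ?_, ?_⟩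
  · rw [lt_sqrt zero_le_one]
    linarith
  · rw [lichX, sq_sqrt h0]
    have h1 : (1 : ℝ) / 4 ≤ lichQ l (2 + 2 * |A|) / (3 * (2 + 2 * |A|) ^ 3) := by
      rw [le_div_iff₀ (by positivity)]
      have h2 := lt_lichQ_of_one_le hl' (by linarith : 1 ≤ 2 + 2 * |A|)
      have h3 : 0 < (2 + 2 * |A|) ^ 3 := by positivity
      nlinarith
    have h4 : (1 : ℝ) / 2 ≤ √(lichQ l (2 + 2 * |A|) / (3 * (2 + 2 * |A|) ^ 3)) :=
      le_sqrt_of_sq_le (by linarith)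
    have := le_abs_self A
    nlinarith

theorem lichF_eq_lichX_div {l m u : ℝ} (hl : 0 < l) (hl' : l < 1 / 2) (hm : 0 < m)
    (hD : lichD l (m ^ 2) = 0) (hu : m < u) : lichF l u = lichX l u / √(lichN l u) := by
  have hu0 := hm.trans hu
  have hDu := lichD_pos hl hm hD hu
  have hQ := lichQ_pos hl hl' hm hD hu.le
  have hS : 0 < √(lichQ l (u ^ 2) / (3 * (u ^ 2) ^ 3)) := sqrt_pos.2 (by positivity)
  rw [lichF_eq hu0.ne', sqrt_lichN hu0 hDu, lichX]
  field_simp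

theorem lichF_root {l m : ℝ} (hm : 0 < m) (hD : lichD l (m ^ 2) = 0) : lichF l m = 0 := by
  rw [lichF_eq hm.ne', hD]
  simp

theorem lichF_pos_of_lt_root {l m u : ℝ} (hl : 0 < l) (hm : 0 < m) (hm1 : m < 1)
    (hD : lichD l (m ^ 2) = 0) (hu : 0 < u) (hum : u < m) : 0 < lichF l u := by
  rw [lichF_eq hu.ne']
  have h1 : u ^ 4 < m ^ 4 := by gcongr
  have h2 := lt_pow_four_of_lichD_eq_zero hl hm hD
  have h3 : lichD l (u ^ 2) < 0 := by
    rw [lichD_sub hD]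
    exact mul_neg_of_neg_of_pos (by linarith) (by nlinarith [pow_pos hu 4])
  have h4 : u ^ 2 - 1 < 0 := by nlinarith
  apply mul_pos_of_neg_of_neg h4
  exact div_neg_of_neg_of_pos (mul_neg_of_pos_of_neg (by positivity) h3) (by positivity)

theorem lich_potentialWell {l m : ℝ} (hl : 0 < l) (hl' : l < 1 / 2) (hm : 0 < m) (hm1 : m < 1)
    (hD : lichD l (m ^ 2) = 0) :
    PotentialWell m 1 (lichF l) (lichX l) (lichN l) (lichN' l) where
  pos := hm
  lt := hm1
  X_continuousOn := (lichX_continuousOn l).mono fun _ hu => hm.trans_le hu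
  X_center := by simp [lichX]
  X_hasDerivAt u hu :=
    lichX_hasDerivAt (hm.trans hu) (lichD_pos hl hm hD hu) (lichQ_pos hl hl' hm hD hu.le)
  N_pos u hu := lichN_pos hl hl' hm hD hu
  N_hasDerivAt u hu := lichN_hasDerivAt (hm.trans hu) (lichD_pos hl hm hD hu)
  N'_strictMonoOn := lichN'_strictMonoOn hl hl' hm hD
  force_eq u hu := lichF_eq_lichX_div hl hl' hm hD hu
  exists_neg_le := by
    obtain ⟨M, hM, h⟩ := exists_le_lichX hl' (-lichX l m)
    exact ⟨M, hm1.trans hM, h⟩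
  force_m := lichF_root hm hD
  force_pos u hu hum := lichF_pos_of_lt_root hl hm hm1 hD hu hum
  force_contDiffOn := lichF_contDiffOn l

/-- Lengths are multiplied by c and time is sped up by σ, so N picks up σ⁻² and `N'` changes only by
a positive factor and dilation of its argument. -/
theorem PotentialWell.scale {m : ℝ} {f X N N' : ℝ → ℝ} (W : PotentialWell m 1 f X N N')
    {c σ : ℝ} (hc : 0 < c) (hσ : 0 < σ) :
    PotentialWell (c * m) c (fun x => c * σ ^ 2 * f (x / c)) (fun x => c * σ * X (x / c))
      (fun x => N (x / c) / σ ^ 2) (fun x => N' (x / c) / (c * σ ^ 2)) := by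
  have hdiv : ∀ u, c * m < u → m < u / c := fun u hu => by
    rw [lt_div_iff₀ hc]; linarith
  have hd : ∀ u, HasDerivAt (fun x => x / c) (1 / c) u := fun u => (hasDerivAt_id u).div_const c
  have hsqrt : ∀ u, √(N (u / c) / σ ^ 2) = √(N (u / c)) / σ := fun u => by
    rw [sqrt_div' _ (sq_nonneg σ), sqrt_sq hσ.le]
  refine ⟨mul_pos hc W.pos, by nlinarith [W.lt], ?_, ?_, ?_, ?_, ?_, ?_, ?_, ?_, ?_, ?_, ?_⟩
  · apply ContinuousOn.mul (by fun_prop)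
    apply W.X_continuousOn.comp (by fun_prop)
    intro u hu
    exact Set.mem_Ici.2 ((le_div_iff₀ hc).2 (by linarith [Set.mem_Ici.1 hu]))
  · simp [hc.ne', W.X_center]
  · intro u hu
    have h := ((W.X_hasDerivAt _ (hdiv u hu)).comp u (hd u)).const_mul (c * σ)
    refine h.congr_deriv ?_
    rw [hsqrt]
    have := sqrt_pos.2 (W.N_pos _ (hdiv u hu))
    field_simp
  · intro u hu
    have := W.N_pos _ (hdiv u hu)
    positivity
  · intro u hu
    have h := ((W.N_hasDerivAt _ (hdiv u hu)).comp u (hd u)).div_const (σ ^ 2)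
    refine h.congr_deriv ?_
    field_simp
  · intro u hu v hv huv
    have := W.N'_strictMonoOn (hdiv u hu) (hdiv v hv) (div_lt_div_of_pos_right huv hc)
    simp only
    gcongr
  · intro u hu
    have := sqrt_pos.2 (W.N_pos _ (hdiv u hu))
    rw [hsqrt, W.force_eq _ (hdiv u hu)]
    field_simp
  · obtain ⟨M, hM, h⟩ := W.exists_neg_le
    refine ⟨c * M, by gcongr, ?_⟩
    rw [mul_div_cancel_left₀ _ hc.ne', mul_div_cancel_left₀ _ hc.ne', ← mul_neg]
    gcongr
  · simp [mul_div_cancel_left₀ _ hc.ne', W.force_m]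
  · intro u hu hum
    have := W.force_pos (u / c) (by positivity) (by rw [div_lt_iff₀ hc]; linarith)
    positivity
  · apply contDiffOn_const.mul
    apply W.force_contDiffOn.comp (contDiff_id.div_const c).contDiffOn
    intro u hu
    exact div_pos hu hc

/-- This is 1/f'(1), the inverse squared frequency of small oscillations of `lichF`. -/
theorem lichN_one {l : ℝ} (hl' : l < 1 / 2) : lichN l 1 = 1 / (4 * (1 - 2 * l)) := by
  have : 1 - 2 * l ≠ 0 := by linarith
  have h1 : lichD l 1 = 1 - 2 * l := by rw [lichD]; ring
  have h2 : lichQ l 1 = 3 * (1 - 2 * l) := by rw [lichQ]; ring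
  rw [lichN, one_pow, h1, h2]
  field_simp
  norm_num

theorem PotentialWell.force_eq_zero_iff {m c : ℝ} {f X N N' : ℝ → ℝ}
    (W : PotentialWell m c f X N N') {u : ℝ} (hu : 0 < u) : f u = 0 ↔ u = m ∨ u = c := by
  constructor
  · intro h
    rcases lt_trichotomy u m with hlt | heq | hgt
    · exact absurd h (W.force_pos u hu hlt).ne'
    · exact Or.inl heq
    · refine Or.inr (W.strictMonoOn.injOn hgt.le W.lt.le ?_)
      have := sqrt_pos.2 (W.N_pos u hgt)
      rw [W.force_eq u hgt, div_eq_zero_iff, or_iff_left this.ne'] at h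
      rw [h, W.X_center]
  · rintro (rfl | rfl)
    · exact W.force_m
    · exact W.force_c

theorem isPeriodicSolution_const_iff {f : ℝ → ℝ} {a : ℝ} :
    IsPeriodicSolution f (fun _ => a) ↔ 0 < a ∧ f a = 0 := by
  constructor
  · intro h
    exact ⟨h.pos 0, h.force_eq_zero_of_eventually_eq (t := 0) Filter.EventuallyEq.rfl⟩
  · rintro ⟨ha, h0⟩
    exact ⟨contDiff_const, fun _ => rfl, fun _ => ha, fun t => by simp [h0]⟩

/-! ### Counting classes of solutions -/

section Counting

variable {T R β α m c : ℝ} {f X N N' : ℝ → ℝ}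

theorem LichSolution.toClass_eq_iff {φ χ : LichSolution T R β α} :
    φ.toClass = χ.toClass ↔ ∃ s : ℝ, ∀ ψ, χ.1 ψ = φ.1 (ψ + s) :=
  ⟨fun h => Quotient.exact h, fun h => Quotient.sound h⟩

theorem isLichSolution_const_iff (W : PotentialWell m c f X N N')
    (hf : ∀ φ, IsLichSolution T R β α φ ↔ IsPeriodicSolution f φ) {a : ℝ} :
    IsLichSolution T R β α (fun _ => a) ↔ a = m ∨ a = c := by
  rw [hf, isPeriodicSolution_const_iff]
  constructor
  · rintro ⟨ha, h⟩
    exact (W.force_eq_zero_iff ha).1 h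
  · intro h
    have ha : 0 < a := by
      rcases h with rfl | rfl
      · exact W.pos
      · exact W.pos.trans W.lt
    exact ⟨ha, (W.force_eq_zero_iff ha).2 h⟩

theorem phiPlus_eq (W : PotentialWell m c f X N N')
    (hf : ∀ φ, IsLichSolution T R β α φ ↔ IsPeriodicSolution f φ) : phiPlus T R β α = c := by
  apply IsGreatest.csSup_eq
  refine ⟨(isLichSolution_const_iff W hf).2 (Or.inr rfl), fun a ha => ?_⟩
  rcases (isLichSolution_const_iff W hf).1 ha with rfl | rfl
  · exact W.lt.le
  · exact le_rfl

theorem constClasses_encard (W : PotentialWell m c f X N N')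
    (hf : ∀ φ, IsLichSolution T R β α φ ↔ IsPeriodicSolution f φ) :
    (constClasses T R β α).encard = 2 := by
  set χm : LichSolution T R β α := ⟨fun _ => m, (isLichSolution_const_iff W hf).2 (Or.inl rfl)⟩
    with hχm
  set χc : LichSolution T R β α := ⟨fun _ => c, (isLichSolution_const_iff W hf).2 (Or.inr rfl)⟩
    with hχc
  have h : constClasses T R β α = {χm.toClass, χc.toClass} := by
    ext q
    constructor
    · rintro ⟨φ, rfl, a, ha⟩
      have h1 : IsLichSolution T R β α (fun _ => a) := by
        have := φ.2
        rwa [show φ.1 = fun _ => a from funext ha] at this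
      rcases (isLichSolution_const_iff W hf).1 h1 with rfl | rfl
      · exact Or.inl (congrArg _ (Subtype.ext (funext ha)))
      · exact Or.inr (congrArg _ (Subtype.ext (funext ha)))
    · rintro (rfl | rfl)
      · exact ⟨χm, rfl, m, fun _ => rfl⟩
      · exact ⟨χc, rfl, c, fun _ => rfl⟩
  rw [h, Set.encard_pair]
  intro heq
  obtain ⟨s, hs⟩ := LichSolution.toClass_eq_iff.1 heq
  exact W.lt.ne' (hs 0)

theorem LichSolution.exists_eq_orbit (W : PotentialWell m c f X N N')
    (hf : ∀ φ, IsLichSolution T R β α φ ↔ IsPeriodicSolution f φ) {φ : LichSolution T R β α}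
    (hφ : ¬ φ.IsConst) : ∃ n : ℕ, 1 ≤ n ∧ ∃ r ∈ Set.Ioo 0 (-X m),
      n * wellPeriod m X N r = 2 * π ∧ ∃ s, ∀ t, φ.1 t = wellOrbit m X N r (t + s) := by
  have hsol := (hf φ.1).1 φ.2
  have hne : ∃ s t, φ.1 s ≠ φ.1 t := by
    by_contra! h
    exact hφ ⟨φ.1 0, fun ψ => h ψ 0⟩
  obtain ⟨r, hr, s, hs⟩ := W.exists_eq_orbit hsol hne
  have hper := hsol.periodic
  rw [show φ.1 = fun t => wellOrbit m X N r (t + s) from funext hs] at hper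
  obtain ⟨n, hn, hP⟩ := W.exists_nat_mul_period hr.1 hr.2 hper
  exact ⟨n, hn, r, hr, hP, s, hs⟩

theorem PotentialWell.exists_nat_mul_period_eq_iff (W : PotentialWell m c f X N N') {n : ℕ}
    (hn : 1 ≤ n) :
    (∃ r ∈ Set.Ioo 0 (-X m), n * wellPeriod m X N r = 2 * π) ↔ n * √(N c) < 1 := by
  have hn0 : (0 : ℝ) < n := by exact_mod_cast hn
  have h := W.exists_period_eq_iff (2 * π / n)
  rw [lt_div_iff₀ hn0] at h
  have h2 : 2 * π * √(N c) * n < 2 * π ↔ n * √(N c) < 1 := by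
    rw [mul_assoc, mul_comm (√(N c))]
    exact mul_lt_iff_lt_one_right two_pi_pos
  rw [← h2, ← h]
  simp only [eq_div_iff hn0.ne', mul_comm]

/-- Strict monotonicity of the period gives one class for each n ≤ k and no others; the winding
number recovers n, so these classes are distinct. -/
theorem nonconstClasses_encard_and_index (W : PotentialWell m c f X N N')
    (hf : ∀ φ, IsLichSolution T R β α φ ↔ IsPeriodicSolution f φ) (hT : 0 < T) {k : ℕ}
    (hk : ∀ n : ℕ, 1 ≤ n → (n * √(N c) < 1 ↔ n ≤ k)) :
    (nonconstClasses T R β α).encard = k ∧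
      ∀ n : ℕ, 1 ≤ n → n ≤ k →
        ∃! q : LichClass T R β α,
          ∃ φ : LichSolution T R β α, φ.toClass = q ∧ ¬ φ.IsConst ∧ φ.HasIndex n := by
  have hex : ∀ n : ℕ, ∃ χ : LichSolution T R β α, 1 ≤ n → n ≤ k →
      ∃ r ∈ Set.Ioo 0 (-X m), n * wellPeriod m X N r = 2 * π ∧ χ.1 = wellOrbit m X N r := by
    intro n
    by_cases hn : 1 ≤ n ∧ n ≤ k
    · obtain ⟨r, hr, hP⟩ := (W.exists_nat_mul_period_eq_iff hn.1).2 ((hk n hn.1).2 hn.2)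
      exact ⟨⟨wellOrbit m X N r, (hf _).2 (W.orbit_isPeriodicSolution hr.1 hr.2 hP)⟩,
        fun _ _ => ⟨r, hr, hP, rfl⟩⟩
    · exact ⟨⟨fun _ => c, (isLichSolution_const_iff W hf).2 (Or.inr rfl)⟩,
        fun h1 h2 => absurd ⟨h1, h2⟩ hn⟩
  choose χ hχ using hex
  have hindex : ∀ n, 1 ≤ n → n ≤ k → ∀ φ : LichSolution T R β α,
      (χ n).toClass = φ.toClass → φ.HasIndex n := by
    intro n h1 h2 φ hφ
    obtain ⟨r, hr, hP, hor⟩ := hχ n h1 h2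
    obtain ⟨s, hs⟩ := LichSolution.toClass_eq_iff.1 hφ
    rw [hor] at hs
    have := W.orbit_windsClockwise hr.1 hr.2 hP hs (div_pos two_pi_pos hT)
    rw [LichSolution.HasIndex, phiPlus_eq W hf]
    exact_mod_cast this
  have hnonconst : ∀ n, 1 ≤ n → n ≤ k → ¬ (χ n).IsConst := by
    rintro n h1 h2 ⟨a, ha⟩
    obtain ⟨r, hr, hP, hor⟩ := hχ n h1 h2
    rw [hor] at ha
    exact W.orbit_not_const hr.1 hr.2 (by rw [ha, ha])
  have hclass : ∀ φ : LichSolution T R β α, ¬ φ.IsConst →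
      ∃ n, 1 ≤ n ∧ n ≤ k ∧ (χ n).toClass = φ.toClass := by
    intro φ hφ
    obtain ⟨n, hn, r, hr, hP, s, hs⟩ := LichSolution.exists_eq_orbit W hf hφ
    have hnk := (hk n hn).1 ((W.exists_nat_mul_period_eq_iff hn).1 ⟨r, hr, hP⟩)
    obtain ⟨r', hr', hP', hor⟩ := hχ n hn hnk
    have hn0 : (0 : ℝ) < n := by exact_mod_cast hn
    have : r = r' := W.period_strictMonoOn.injOn ⟨hr.1.le, hr.2⟩ ⟨hr'.1.le, hr'.2⟩
      (mul_left_cancel₀ hn0.ne' (hP.trans hP'.symm))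
    subst this
    exact ⟨n, hn, hnk, LichSolution.toClass_eq_iff.2 ⟨s, fun t => by rw [hor, hs]⟩⟩
  constructor
  · have himg : nonconstClasses T R β α =
        (fun n => (χ n).toClass) '' (Finset.Icc 1 k : Finset ℕ) := by
      ext q
      constructor
      · rintro ⟨φ, rfl, hφ⟩
        obtain ⟨n, h1, h2, h3⟩ := hclass φ hφ
        exact ⟨n, by simp [h1, h2], h3⟩
      · rintro ⟨n, hn, rfl⟩
        rw [Finset.mem_coe, Finset.mem_Icc] at hn
        exact ⟨χ n, rfl, hnonconst n hn.1 hn.2⟩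
    rw [himg, Set.InjOn.encard_image, Set.encard_coe_eq_coe_finsetCard, Nat.card_Icc,
      Nat.add_sub_cancel]
    intro n hn j hj hnj
    rw [Finset.mem_coe, Finset.mem_Icc] at hn hj
    have h1 := hindex n hn.1 hn.2 (χ j) hnj
    have h2 := hindex j hj.1 hj.2 (χ j) rfl
    exact_mod_cast WindsClockwise.unique h1 h2
  · intro n h1 h2
    refine ⟨(χ n).toClass, ⟨χ n, rfl, hnonconst n h1 h2, hindex n h1 h2 _ rfl⟩, ?_⟩
    rintro _ ⟨φ, rfl, hφ, hi⟩
    obtain ⟨j, hj1, hj2, hj⟩ := hclass φ hφ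
    have : (j : ℤ) = n := WindsClockwise.unique (hindex j hj1 hj2 φ hj) hi
    have : j = n := by exact_mod_cast this
    rw [← hj, this]

end Counting

/-! ### The Lichnerowicz force, its equilibria and the ranges of α -/

/-- The force law of the equation solved for `φ''`. -/
noncomputable def lichForce (T R β α u : ℝ) : ℝ :=
  T ^ 2 / (2 * π) ^ 2 * (1 / 8) * (β ^ 2 * u ^ 5 + α ^ 2 * u ^ (-7 : ℤ) - R * u)

/-- The value of `α²` for which `v^(1/4)` is a constant solution. -/
noncomputable def lichCubic (R β v : ℝ) : ℝ := v ^ 2 * (R - β ^ 2 * v)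

variable {T R β α : ℝ}

theorem lichForce_eq {u : ℝ} (hu : 0 < u) : lichForce T R β α u =
    T ^ 2 / (2 * π) ^ 2 * (1 / 8) * ((α ^ 2 - lichCubic R β (u ^ 4)) / u ^ 7) := by
  rw [lichForce, lichCubic, show (-7 : ℤ) = -((7 : ℕ) : ℤ) by norm_num, zpow_neg, zpow_natCast]
  field_simp
  ring

theorem isLichSolution_iff (hT : 0 < T) {f : ℝ → ℝ} (hf : ∀ u, 0 < u → f u = lichForce T R β α u)
    (φ : ℝ → ℝ) : IsLichSolution T R β α φ ↔ IsPeriodicSolution f φ := by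
  have hpi := pi_pos
  constructor
  · intro h
    refine ⟨h.contDiff, h.periodic, h.pos, fun t => ?_⟩
    have := h.ode t
    rw [hf _ (h.pos t), lichForce]
    field_simp at this ⊢
    linarith
  · intro h
    refine ⟨h.contDiff, h.periodic, h.pos, fun t => ?_⟩
    have := h.ode t
    rw [hf _ (h.pos t), lichForce] at this
    rw [this]
    field_simp

theorem lichForce_eq_zero_iff (hT : 0 < T) {u : ℝ} (hu : 0 < u) :
    lichForce T R β α u = 0 ↔ α ^ 2 = lichCubic R β (u ^ 4) := by
  have hpi := pi_pos
  have h : T ^ 2 / (2 * π) ^ 2 * (1 / 8) ≠ 0 := by positivity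
  rw [lichForce_eq hu, mul_eq_zero, or_iff_right h, div_eq_zero_iff, or_iff_left (pow_pos hu 7).ne',
    sub_eq_zero]

theorem sq_alphaMax (hR : 0 < R) (hβ : 0 < β) :
    alphaMax R β ^ 2 = 4 * R ^ 3 / (27 * β ^ 4) := by
  have h1 : (R ^ (3 / 2 : ℝ)) ^ 2 = R ^ 3 := by
    rw [← rpow_natCast, ← rpow_mul hR.le, ← rpow_natCast]
    norm_num
  have h2 : √(3 : ℝ) ^ 2 = 3 := sq_sqrt (by norm_num)
  rw [alphaMax, mul_pow, h1, div_pow, mul_pow, mul_pow, h2]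
  field_simp
  norm_num

/-- At its critical point 2R/(3β²) the cubic attains α_max², hence the double root; the remaining
root is negative. -/
theorem alphaMax_sq_sub_lichCubic (hR : 0 < R) (hβ : 0 < β) (v : ℝ) :
    alphaMax R β ^ 2 - lichCubic R β v =
      (v - 2 * R / (3 * β ^ 2)) ^ 2 * (β ^ 2 * v + R / 3) := by
  rw [sq_alphaMax hR hβ, lichCubic]
  field_simp
  ring

theorem lichCubic_le_alphaMax_sq (hR : 0 < R) (hβ : 0 < β) {v : ℝ} (hv : 0 < v) :
    lichCubic R β v ≤ alphaMax R β ^ 2 := by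
  rw [← sub_nonneg, alphaMax_sq_sub_lichCubic hR hβ]
  positivity

theorem alphaMax_pos (hR : 0 < R) (hβ : 0 < β) : 0 < alphaMax R β := by
  rw [alphaMax]
  positivity

/-- For `|α| ≥ α_max` every solution is constant. -/
theorem LichSolution.exists_const (hT : 0 < T) (hR : 0 < R) (hβ : 0 < β)
    (hα : alphaMax R β ^ 2 ≤ α ^ 2) (φ : LichSolution T R β α) :
    ∃ a, 0 < a ∧ α ^ 2 = lichCubic R β (a ^ 4) ∧ φ.1 = fun _ => a := by
  have hpi := pi_pos
  have h := (isLichSolution_iff hT (fun _ _ => rfl) φ.1).1 φ.2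
  have hconst := h.eq_of_force_nonneg fun t => by
    have hpos := h.pos t
    have := lichCubic_le_alphaMax_sq hR hβ (pow_pos hpos 4)
    have h1 : 0 ≤ α ^ 2 - lichCubic R β (φ.1 t ^ 4) := by linarith
    rw [lichForce_eq hpos]
    positivity
  have hφ : φ.1 = fun _ => φ.1 0 := funext fun t => hconst t 0
  rw [hφ, isPeriodicSolution_const_iff] at h
  exact ⟨φ.1 0, h.1, (lichForce_eq_zero_iff hT h.1).1 h.2, hφ⟩

theorem lichSolution_isEmpty (hT : 0 < T) (hR : 0 < R) (hβ : 0 < β)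
    (hα : α ∉ Set.Icc (-alphaMax R β) (alphaMax R β)) : IsEmpty (LichSolution T R β α) := by
  have h1 : alphaMax R β ^ 2 < α ^ 2 := by
    rw [sq_lt_sq, abs_of_pos (alphaMax_pos hR hβ)]
    by_contra! h
    exact hα (abs_le.1 h)
  refine ⟨fun φ => ?_⟩
  obtain ⟨a, ha, h2, -⟩ := φ.exists_const hT hR hβ h1.le
  have := lichCubic_le_alphaMax_sq hR hβ (pow_pos ha 4)
  linarith

theorem lichClass_card_eq_one (hT : 0 < T) (hR : 0 < R) (hβ : 0 < β)
    (hα : α = alphaMax R β ∨ α = -alphaMax R β) : Nat.card (LichClass T R β α) = 1 := by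
  have hα2 : α ^ 2 = alphaMax R β ^ 2 := by
    rcases hα with rfl | rfl
    · rfl
    · exact neg_sq _
  have hv : 0 < 2 * R / (3 * β ^ 2) := by positivity
  have hroot : ∀ a, 0 < a → (α ^ 2 = lichCubic R β (a ^ 4) ↔ a ^ 4 = 2 * R / (3 * β ^ 2)) := by
    intro a ha
    have h3 : β ^ 2 * a ^ 4 + R / 3 ≠ 0 := by positivity
    rw [hα2, ← sub_eq_zero, alphaMax_sq_sub_lichCubic hR hβ, mul_eq_zero, or_iff_left h3,
      sq_eq_zero_iff, sub_eq_zero]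
  rw [Nat.card_eq_one_iff_unique]
  constructor
  · refine ⟨fun p q => ?_⟩
    obtain ⟨φ, rfl⟩ := Quotient.exists_rep p
    obtain ⟨χ, rfl⟩ := Quotient.exists_rep q
    obtain ⟨a, ha, ha1, ha2⟩ := φ.exists_const hT hR hβ hα2.ge
    obtain ⟨b, hb, hb1, hb2⟩ := χ.exists_const hT hR hβ hα2.ge
    have hab : a = b := (pow_left_inj₀ ha.le hb.le four_ne_zero).1
      (((hroot a ha).1 ha1).trans ((hroot b hb).1 hb1).symm)
    exact congrArg _ (Subtype.ext (by rw [ha2, hb2, hab]))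
  · have ha : 0 < √√(2 * R / (3 * β ^ 2)) := sqrt_pos.2 (sqrt_pos.2 hv)
    have ha4 : √√(2 * R / (3 * β ^ 2)) ^ 4 = 2 * R / (3 * β ^ 2) := by
      rw [show 4 = 2 * 2 from rfl, pow_mul, sq_sqrt (sqrt_nonneg _), sq_sqrt hv.le]
    exact ⟨LichSolution.toClass ⟨fun _ => √√(2 * R / (3 * β ^ 2)),
      (isLichSolution_iff hT (fun _ _ => rfl) _).2 (isPeriodicSolution_const_iff.2
        ⟨ha, (lichForce_eq_zero_iff hT ha).2 ((hroot _ ha).2 ha4)⟩)⟩⟩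

theorem lichCubic_strictAntiOn (hR : 0 < R) (hβ : 0 < β) :
    StrictAntiOn (lichCubic R β) (Set.Ici (2 * R / (3 * β ^ 2))) := by
  intro v hv w hw hvw
  have h1 := alphaMax_sq_sub_lichCubic hR hβ v
  have h2 := alphaMax_sq_sub_lichCubic hR hβ w
  have hv0 : 0 < 2 * R / (3 * β ^ 2) := by positivity
  have hv' : 0 ≤ v - 2 * R / (3 * β ^ 2) := sub_nonneg.2 hv
  have hvpos : 0 < v := hv0.trans_le hv
  have h3 : (v - 2 * R / (3 * β ^ 2)) ^ 2 * (β ^ 2 * v + R / 3) <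
      (w - 2 * R / (3 * β ^ 2)) ^ 2 * (β ^ 2 * w + R / 3) := by
    apply mul_lt_mul'' (by gcongr) (by gcongr) (by positivity) (by positivity)
  linarith

/-- The fourth power of `φ₊(α_{k,+})`. -/
noncomputable def bifurcationValue (T R β : ℝ) (k : ℕ) : ℝ :=
  2 * (R + (2 * π / T) ^ 2 * (k : ℝ) ^ 2) / (3 * β ^ 2)

theorem le_bifurcationValue (hβ : 0 < β) (k : ℕ) :
    2 * R / (3 * β ^ 2) ≤ bifurcationValue T R β k := by
  rw [bifurcationValue]
  gcongr
  have : 0 ≤ (2 * π / T) ^ 2 * (k : ℝ) ^ 2 := by positivity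
  linarith

theorem bifurcationValue_strictMono (hT : 0 < T) (hβ : 0 < β) :
    StrictMono (bifurcationValue T R β) := by
  intro j k hjk
  have hpi := pi_pos
  rw [bifurcationValue, bifurcationValue]
  gcongr

theorem alphaPlus_nonneg (hR : 0 < R) (k : ℕ) : 0 ≤ alphaPlus T R β k := by
  rw [alphaPlus]
  positivity

/-- At the bifurcation value, R - β²v is one third of the radicand of α_{k,+}; `hk` makes that
radicand nonnegative. -/
theorem sq_alphaPlus (hβ : 0 < β) {k : ℕ}
    (hk : 2 * (2 * π / T) ^ 2 * (k : ℝ) ^ 2 ≤ R) :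
    alphaPlus T R β k ^ 2 = lichCubic R β (bifurcationValue T R β k) := by
  have h2 : √(3 : ℝ) ^ 2 = 3 := sq_sqrt (by norm_num)
  have h3 := sq_sqrt (sub_nonneg.2 hk)
  rw [alphaPlus, mul_pow, mul_pow, h3, div_pow, mul_pow, mul_pow, h2, lichCubic, bifurcationValue]
  generalize (2 * π / T) ^ 2 = x
  field_simp
  ring

/-- The part of the parameter range that matters, in terms of `α²`. -/
theorem sq_bounds_of_mem_alphaRange (hT : 0 < T) (hR : 0 < R) (hβ : 0 < β) {kmax k : ℕ}
    (hkmax : IsGreatest {k : ℕ | 2 * (2 * π / T) ^ 2 * (k : ℝ) ^ 2 < R} kmax)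
    (hα : α ∈ alphaRange T R β kmax k) :
    α ^ 2 < lichCubic R β (bifurcationValue T R β k) ∧
      (lichCubic R β (bifurcationValue T R β (k + 1)) ≤ α ^ 2 ∨
        R ≤ β ^ 2 * bifurcationValue T R β (k + 1)) := by
  have hle : ∀ j, j ≤ kmax → 2 * (2 * π / T) ^ 2 * (j : ℝ) ^ 2 ≤ R := fun j hj => by
    have h1 : 2 * (2 * π / T) ^ 2 * (kmax : ℝ) ^ 2 < R := hkmax.1
    refine le_trans ?_ h1.le
    gcongr
  rcases hα with ⟨hk, hα⟩ | ⟨rfl, hα⟩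
  · rw [← sq_alphaPlus hβ (hle k hk.le), ← sq_alphaPlus hβ (hle (k + 1) hk), sq_lt_sq, sq_le_sq,
      abs_of_nonneg (alphaPlus_nonneg hR k), abs_of_nonneg (alphaPlus_nonneg hR (k + 1))]
    have h0 := alphaPlus_nonneg (T := T) (β := β) hR (k + 1)
    simp only [alphaMinus, Set.mem_union, Set.mem_Ioc, Set.mem_Ico] at hα
    rcases hα with ⟨h1, h2⟩ | ⟨h1, h2⟩
    · rw [abs_of_nonpos (by linarith)]
      exact ⟨by linarith, Or.inl (by linarith)⟩
    · rw [abs_of_nonneg (by linarith)]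
      exact ⟨h2, Or.inl h1⟩
  · rw [← sq_alphaPlus hβ (hle k le_rfl), sq_lt_sq, abs_of_nonneg (alphaPlus_nonneg hR k), abs_lt]
    refine ⟨hα, Or.inr ?_⟩
    -- Maximality of `kmax` puts the next bifurcation value at or beyond R/β², where the cubic is no
    -- longer positive; no α_{k+1,+} is needed.
    have h1 : ¬ 2 * (2 * π / T) ^ 2 * ((k + 1 : ℕ) : ℝ) ^ 2 < R := fun h =>
      absurd (hkmax.2 h) (by omega)
    rw [bifurcationValue]
    generalize (2 * π / T) ^ 2 = x at *
    field_simp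
    linarith

/-- Existence of the stable constant solution, as a root of the cubic. -/
theorem exists_lichCubic_eq (hR : 0 < R) (hβ : 0 < β) (hα0 : α ≠ 0)
    (hα : α ^ 2 < alphaMax R β ^ 2) :
    ∃ v, 2 * R / (3 * β ^ 2) < v ∧ β ^ 2 * v < R ∧ lichCubic R β v = α ^ 2 := by
  have h0 : lichCubic R β (2 * R / (3 * β ^ 2)) = alphaMax R β ^ 2 := by
    have := alphaMax_sq_sub_lichCubic hR hβ (2 * R / (3 * β ^ 2))
    rw [sub_self] at this
    linarith [show (0 : ℝ) ^ 2 * (β ^ 2 * (2 * R / (3 * β ^ 2)) + R / 3) = 0 by ring]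
  have h1 : lichCubic R β (R / β ^ 2) = 0 := by
    rw [lichCubic]
    field_simp
    ring
  have hc : ContinuousOn (lichCubic R β) (Set.Icc (2 * R / (3 * β ^ 2)) (R / β ^ 2)) := by
    unfold lichCubic
    fun_prop
  have hle : 2 * R / (3 * β ^ 2) ≤ R / β ^ 2 := by
    rw [div_le_div_iff₀ (by positivity) (by positivity)]
    nlinarith [mul_pos hR (pow_pos hβ 2)]
  -- On this branch the cubic falls from α_max² to 0; α ≠ 0 keeps v strictly below R/β².
  obtain ⟨v, hv, h⟩ := intermediate_value_Ioo' hle hc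
    (show α ^ 2 ∈ _ by rw [h0, h1]; exact ⟨by positivity, hα⟩)
  refine ⟨v, hv.1, ?_, h⟩
  have := (lt_div_iff₀ (by positivity)).1 hv.2
  linarith

theorem exists_potentialWell (hT : 0 < T) (hβ : 0 < β) {v : ℝ}
    (hv : 2 * R / (3 * β ^ 2) < v) (hv0 : 0 < v) (hv' : β ^ 2 * v < R)
    (hα : lichCubic R β v = α ^ 2) :
    ∃ m c f X N N', PotentialWell m c f X N N' ∧ (∀ u, 0 < u → f u = lichForce T R β α u) ∧
      N c * (3 * β ^ 2 * v - 2 * R) = 2 * (2 * π / T) ^ 2 ∧ 0 < N c := by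
  have hpi := pi_pos
  have hbv : 0 < β ^ 2 * v := by positivity
  -- Dividing by β²v gives R = (1 + l)β²v and α² = lβ²v³. The bounds on v become 0 < l < 1/2.
  obtain ⟨l, hl⟩ : ∃ l, l = (R - β ^ 2 * v) / (β ^ 2 * v) := ⟨_, rfl⟩
  have hl0 : 0 < l := by
    rw [hl]
    exact div_pos (by linarith) hbv
  have hvR : 2 * R < 3 * β ^ 2 * v := by
    rw [div_lt_iff₀ (by positivity)] at hv
    linarith
  have hl1 : l < 1 / 2 := by
    rw [hl, div_lt_iff₀ hbv]
    linarith
  obtain ⟨m, hm, hD⟩ := exists_lichD_eq_zero hl0 hl1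
  obtain ⟨c, hc0, hc⟩ : ∃ c, 0 < c ∧ c ^ 4 = v :=
    ⟨√√v, sqrt_pos.2 (sqrt_pos.2 hv0), by
      rw [show 4 = 2 * 2 from rfl, pow_mul, sq_sqrt (sqrt_nonneg _), sq_sqrt hv0.le]⟩
  obtain ⟨σ, hσ0, hσ⟩ : ∃ σ, 0 < σ ∧ σ ^ 2 = T ^ 2 / (2 * π) ^ 2 * (1 / 8) * (β ^ 2 * v) :=
    ⟨√(T ^ 2 / (2 * π) ^ 2 * (1 / 8) * (β ^ 2 * v)), sqrt_pos.2 (by positivity),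
      sq_sqrt (by positivity)⟩
  have hRl : R = (1 + l) * (β ^ 2 * v) := by
    rw [hl]
    field_simp
    ring
  have hW := (lich_potentialWell hl0 hl1 hm.1 hm.2 hD).scale hc0 hσ0
  refine ⟨_, _, _, _, _, _, hW, fun u hu => ?_, ?_, hW.N_pos c hW.lt⟩
  · rw [lichForce_eq hu, ← hα, lichCubic, lichCubic, hRl, hσ, ← hc]
    simp only [lichF]
    field_simp
    ring
  · rw [div_self hc0.ne', lichN_one hl1, hσ]
    have h2 : 3 * β ^ 2 * v - 2 * R = β ^ 2 * v * (1 - 2 * l) := by rw [hRl]; ring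
    have h3 : 1 - 2 * l ≠ 0 := by linarith
    rw [h2]
    field_simp
    ring

theorem theorem6p6 (T R β : ℝ) (hT : 0 < T) (hR : 0 < R) (hβ : 0 < β)
    (kmax : ℕ)
    (hkmax : IsGreatest {k : ℕ | 2 * (2 * π / T) ^ 2 * (k : ℝ) ^ 2 < R} kmax) :
    (∀ α : ℝ, α ∉ Set.Icc (-alphaMax R β) (alphaMax R β) →
      IsEmpty (LichSolution T R β α)) ∧
    (∀ α : ℝ, α = alphaMax R β ∨ α = -alphaMax R β →
      Nat.card (LichClass T R β α) = 1) ∧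
    (∀ k : ℕ, ∀ α : ℝ, α ≠ 0 → α ∈ alphaRange T R β kmax k →
      (constClasses T R β α).encard = 2 ∧
      (nonconstClasses T R β α).encard = k ∧
      ∀ n : ℕ, 1 ≤ n → n ≤ k →
        ∃! q : LichClass T R β α,
          ∃ φ : LichSolution T R β α, φ.toClass = q ∧ ¬ φ.IsConst ∧ φ.HasIndex n) := by
  refine ⟨fun α hα => lichSolution_isEmpty hT hR hβ hα,
    fun α hα => lichClass_card_eq_one hT hR hβ hα, fun k α hα0 hα => ?_⟩
  have hpi := pi_pos
  obtain ⟨hlt, hge⟩ := sq_bounds_of_mem_alphaRange hT hR hβ hkmax hα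
  have hbase : 0 < 2 * R / (3 * β ^ 2) := by positivity
  have hb : ∀ n, 2 * R / (3 * β ^ 2) ≤ bifurcationValue T R β n := le_bifurcationValue hβ
  have hanti := lichCubic_strictAntiOn hR hβ
  obtain ⟨v, hv, hvR, hvα⟩ := exists_lichCubic_eq hR hβ hα0
    (hlt.trans_le (lichCubic_le_alphaMax_sq hR hβ (hbase.trans_le (hb k))))
  obtain ⟨m, c, f, X, N, N', W, hf, hN, hNpos⟩ :=
    exists_potentialWell hT hβ hv (hbase.trans hv) hvR hvα
  have hsol := isLichSolution_iff hT hf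
  -- The cubic is decreasing on this branch, so the bounds on α² reverse into v_k < v ≤ v_{k+1},
  -- where v_n is the n-th bifurcation value.
  have hkv : bifurcationValue T R β k < v := by
    rw [← hvα] at hlt
    exact (hanti.lt_iff_gt hv.le (hb k)).1 hlt
  have hvk : v ≤ bifurcationValue T R β (k + 1) := by
    rcases hge with h | h
    · rw [← hvα] at h
      exact (hanti.le_iff_ge (hb _) hv.le).1 h
    · exact le_of_mul_le_mul_left (hvR.le.trans h) (by positivity)
  have hmono := bifurcationValue_strictMono (R := R) hT hβ
  have hcount : ∀ n : ℕ, 1 ≤ n → (n * √(N c) < 1 ↔ n ≤ k) := by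
    intro n hn
    -- By `hN`, squaring turns the left side into 2(2π/T)²n² < 3β²v - 2R, which is v_n < v.
    have h1 : n * √(N c) < 1 ↔ bifurcationValue T R β n < v := by
      have hd : 0 < 3 * β ^ 2 * v - 2 * R := by
        have := (div_lt_iff₀ (by positivity)).1 hv
        linarith
      rw [← sq_lt_one_iff₀ (by positivity), mul_pow, sq_sqrt hNpos.le,
        ← mul_lt_iff_lt_one_left hd, mul_assoc, hN, bifurcationValue, div_lt_iff₀ (by positivity)]
      constructor <;> intro h <;> linarith
    rw [h1]
    constructor
    · intro h
      exact Nat.lt_succ_iff.1 (hmono.lt_iff_lt.1 (h.trans_le hvk))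
    · intro h
      exact (hmono.monotone h).trans_lt hkv
  exact ⟨constClasses_encard W hsol, nonconstClasses_encard_and_index W hsol hT hcount⟩
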